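/- An $n$-dimensional chromotopology $A$ is a finite connected bipartite $n$-regular simple graph whose edges are coloured by $n$ colours so that every vertex lies on exactly one edge of each colour and, for any two distinct colours, the edges of these two colours form a disjoint union of $4$-cycles. It is adinkraizable if (i) its graph is the Hasse diagram of a partial order on the vertices having a rank function to $\mathbf{Z}$, and (ii) it has an odd dashing, that is, a map from the edges to $\mathbf{Z}_2$ whose sum over each $2$-coloured $4$-cycle is $1$. Let $I^n_c$ be the cubical chromotopology: its vertices are the bitstrings in $\mathbf{Z}_2^n$, with an edge of colour $i$ between two bitstrings that differ exactly in bit $i$. For a linear code (a $\mathbf{Z}_2$-subspace) $L\subseteq\mathbf{Z}_2^n$, the graph quotient $I^n_c/L$ has vertex set $\mathbf{Z}_2^n/L$, with an edge of colour $i$ between two classes if some representatives of them are joined by an edge of colour $i$ in $I^n_c$. We say that $A$ corresponds to $L$ if $A$ is isomorphic to $I^n_c/L$ as an edge-coloured graph. Let $X(A)$ be the square $2$-complex (with its cellular chain complex over $\mathbf{Z}_2$) whose $0$- and $1$-cells are the vertices and edges of $A$, with one square attached along each $2$-coloured $4$-cycle. Proposition. Let $A$ be an adinkraizable $n$-dimensional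 chromotopology. There is exactly one code $L\subseteq\mathbf{Z}_2^n$ to which $A$ corresponds. For this $L$ and any isomorphism $I^n_c/L\cong A$ of edge-coloured graphs, let $\pi\colon X(I^n_c)\to X(A)$ be the map induced by $I^n_c\to I^n_c/L\cong A$, and let $L$ act on $X(I^n_c)$ by translations. Then: 1. $\pi$ identifies $X(A)$ with the quotient complex $X(I^n_c)/L$: in each dimension the cells of $X(A)$ are the $L$-orbits of cells of $X(I^n_c)$; the induced maps of chain groups commute with the boundary maps, are surjective, and have as kernels the spans of the differences $\ell c-c$ with $\ell\in L$ and $c$ a cell; $\pi$ maps each closed cell onto the corresponding closed cell; and $\pi$ induces a homeomorphism from the orbit space $X(I^n_c)/L$ to $X(A)$. 2. $L$ acts freely on $X(I^n_c)$, both on its points and on its cells of each dimension. 3. $X(I^n_c)$ is simply connected, and $\pi$ is a covering map. 4. $\ell\mapsto(x\mapsto\ell+x)$ is an isomorphism from $L$ to the group of deck transformations of $\pi$. -/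

import Mathlib

open scoped BigOperators

set_option linter.unusedSectionVars false
set_option linter.unusedSimpArgs false

noncomputable section

namespace Adinkra

/-- Bitstrings of length `n`. -/
abbrev Bits (n : ℕ) : Type := Fin n → ZMod 2

/-! ### Four-cycles and chromotopologies -/

/-- The edge with endpoints `u` and `v`. -/
def edgeOf {V : Type*} {G : SimpleGraph V} {u v : V} (h : G.Adj u v) : G.edgeSet := ⟨s(u, v), h⟩

theorem edgeOf_eq_iff {V : Type*} {G : SimpleGraph V} {u v : V} (h : G.Adj u v) (e : G.edgeSet) :
    e = edgeOf h ↔ e.1 = s(u, v) := Subtype.ext_iff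

theorem exists_edgeOf {V : Type*} {G : SimpleGraph V} (e : G.edgeSet) :
    ∃ (u v : V) (h : G.Adj u v), e = edgeOf h := by
  obtain ⟨e, he⟩ := e
  induction e with
  | h u v => exact ⟨u, v, he, rfl⟩

/-- The set of edges of the closed walk `a, b, c, d, a`. -/
def cycleEdges {V : Type*} [DecidableEq V] {G : SimpleGraph V} {a b c d : V} (hab : G.Adj a b)
    (hbc : G.Adj b c) (hcd : G.Adj c d) (hda : G.Adj d a) : Finset G.edgeSet :=
  {edgeOf hab, edgeOf hbc, edgeOf hcd, edgeOf hda}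

/-- The finite set `C` of edges of `G` is the edge set of a `4`-cycle `a, b, c, d` of `G`. -/
def IsFourCycle {V : Type*} [DecidableEq V] (G : SimpleGraph V) (C : Finset G.edgeSet) : Prop :=
  ∃ (a b c d : V) (hab : G.Adj a b) (hbc : G.Adj b c) (hcd : G.Adj c d) (hda : G.Adj d a),
    a ≠ c ∧ b ≠ d ∧ C = cycleEdges hab hbc hcd hda

/-- An `n`-dimensional chromotopology with vertex set `V`: a finite connected bipartite `n`-regular
simple graph with edges coloured by `n` colours, such that every vertex is incident to exactly one
edge of each colour and, for any two distinct colours, the edges of these two colours form a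
disjoint union of `4`-cycles. -/
structure Chromotopology (n : ℕ) (V : Type*) [Fintype V] [DecidableEq V] where
  graph : SimpleGraph V
  connected : graph.Connected
  bipartite : graph.IsBipartite
  regular : ∀ v, (graph.neighborSet v).ncard = n
  color : graph.edgeSet → Fin n
  existsUnique_edge : ∀ (v : V) (i : Fin n), ∃! e : graph.edgeSet, v ∈ e.1 ∧ color e = i
  fourCycles : ∀ i j : Fin n, i ≠ j → ∃ S : Set (Finset graph.edgeSet),
    (∀ C ∈ S, IsFourCycle graph C) ∧
    (∀ C ∈ S, ∀ C' ∈ S, C ≠ C' → ∀ e ∈ C, ∀ e' ∈ C', ∀ v ∈ e.1, v ∉ e'.1) ∧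
    ∀ e : graph.edgeSet, (color e = i ∨ color e = j) ↔ ∃ C ∈ S, e ∈ C

section Defs

variable {n : ℕ} {V W U : Type*} [Fintype V] [DecidableEq V] [Fintype W] [DecidableEq W]
  [Fintype U] [DecidableEq U]

namespace Chromotopology

/-- The edges of `A`, which are the `1`-cells of the square complex of `A`. -/
abbrev Edge (A : Chromotopology n V) : Type _ := A.graph.edgeSet

/-- `u` and `v` are joined by an edge of colour `i`. -/
def ColorAdj (A : Chromotopology n V) (i : Fin n) (u v : V) : Prop :=
  ∃ h : A.graph.Adj u v, A.color (edgeOf h) = i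

/-- A `2`-coloured `4`-cycle: a `4`-cycle whose edges use a total of two colours. -/
def IsTwoColoredFourCycle (A : Chromotopology n V) (C : Finset A.Edge) : Prop :=
  IsFourCycle A.graph C ∧ (C.image A.color).card = 2

/-- The `2`-coloured `4`-cycles of `A`, which are the `2`-cells of the square complex of `A`. -/
abbrev Face (A : Chromotopology n V) : Type _ := {C : Finset A.Edge // A.IsTwoColoredFourCycle C}

/-- An odd dashing: the sum over every `2`-coloured `4`-cycle is `1` in `ZMod 2`. -/
def IsOddDashing (A : Chromotopology n V) (d : A.Edge → ZMod 2) : Prop :=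
  ∀ C : A.Face, ∑ e ∈ C.1, d e = 1

/-- A partial order on the vertices with a rank function, whose Hasse diagram is the graph of
`A`. -/
def IsRankedPoset (A : Chromotopology n V) (P : PartialOrder V) (h : V → ℤ) : Prop :=
  (∀ u v : V, @CovBy V P.toPreorder.toLT u v → h v = h u + 1) ∧
  ∀ u v : V, A.graph.Adj u v ↔
    (@CovBy V P.toPreorder.toLT u v ∨ @CovBy V P.toPreorder.toLT v u)

/-- `A` can be made into an adinkra, that is, can be both ranked and dashed. -/
def Adinkraizable (A : Chromotopology n V) : Prop :=
  (∃ (P : PartialOrder V) (h : V → ℤ), A.IsRankedPoset P h) ∧ ∃ d, A.IsOddDashing d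

/-! ### The mod-two chain complex of the square complex -/

/-- The boundary map `C₁ → C₀`: an edge goes to the sum of its two endpoints. -/
def boundary₁ (A : Chromotopology n V) : (A.Edge →₀ ZMod 2) →ₗ[ZMod 2] (V →₀ ZMod 2) :=
  Finsupp.linearCombination (ZMod 2) fun e : A.Edge => ∑ v ∈ e.1.toFinset, Finsupp.single v 1

/-- The boundary map `C₂ → C₁`: a `2`-coloured `4`-cycle goes to the sum of its four edges. -/
def boundary₂ (A : Chromotopology n V) : (A.Face →₀ ZMod 2) →ₗ[ZMod 2] (A.Edge →₀ ZMod 2) :=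
  Finsupp.linearCombination (ZMod 2) fun C : A.Face => ∑ e ∈ C.1, Finsupp.single e 1

end Chromotopology

/-! ### The geometric realization

The cells are realized in `V → ℝ`, with a vertex `v` at the corresponding standard basis vector,
an edge as the segment between its endpoints, and a `2`-coloured `4`-cycle as the bilinearly
embedded unit square with the four vertices of the cycle as corners. -/

/-- The point with parameters `(x, y)` in the square with corners `a, b, c, d`. -/
def squarePoint (a b c d : V) (x y : ℝ) : V → ℝ :=
  ((1 - x) * (1 - y)) • Pi.single a 1 + (x * (1 - y)) • Pi.single b 1 +
    (x * y) • Pi.single c 1 + ((1 - x) * y) • Pi.single d 1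

/-- The `0`-cell at `v`. -/
def vertexCell (v : V) : Set (V → ℝ) := {Pi.single v 1}

theorem squarePoint_support {a b c d : V} (hab : a ≠ b) (hac : a ≠ c) (had : a ≠ d) (hbc : b ≠ c)
    (hbd : b ≠ d) (hcd : c ≠ d) {x y : ℝ} (hx : x ∈ Set.Ioo (0 : ℝ) 1) (hy : y ∈ Set.Ioo (0 : ℝ) 1)
    (v : V) : squarePoint a b c d x y v ≠ 0 ↔ v = a ∨ v = b ∨ v = c ∨ v = d := by
  obtain ⟨hx0, hx1⟩ := hx
  obtain ⟨hy0, hy1⟩ := hy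
  have h1 : 1 - x ≠ 0 := by linarith
  have h2 : 1 - y ≠ 0 := by linarith
  by_cases ha : v = a
  · subst ha
    simp [squarePoint, Pi.single_apply, hab, hac, had, h1, h2]
  by_cases hb : v = b
  · subst hb
    simp [squarePoint, Pi.single_apply, hab.symm, hbc, hbd, h2, hx0.ne']
  by_cases hc : v = c
  · subst hc
    simp [squarePoint, Pi.single_apply, hac.symm, hbc.symm, hcd, hx0.ne', hy0.ne']
  by_cases hd : v = d
  · subst hd
    simp [squarePoint, Pi.single_apply, had.symm, hbd.symm, hcd.symm, h1, hy0.ne']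
  simp [squarePoint, Pi.single_apply, ha, hb, hc, hd]

theorem squarePoint_injective {a b c d : V} (hab : a ≠ b) (hac : a ≠ c) (had : a ≠ d) (hbc : b ≠ c)
    (hbd : b ≠ d) (hcd : c ≠ d) {x y x' y' : ℝ}
    (h : squarePoint a b c d x y = squarePoint a b c d x' y') : x = x' ∧ y = y' := by
  have h2 := congrFun h b
  have h3 := congrFun h c
  have h4 := congrFun h d
  simp [squarePoint, Pi.single_apply, hab.symm, hbc, hbd] at h2
  simp [squarePoint, Pi.single_apply, hac.symm, hbc.symm, hcd] at h3
  simp [squarePoint, Pi.single_apply, had.symm, hbd.symm, hcd.symm] at h4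
  constructor <;> linarith

/-- In a bipartite graph the edges of a `4`-cycle are all the edges between its vertices. -/
theorem mem_fourCycle_iff {G : SimpleGraph V} (hG : G.IsBipartite) {a b c d : V} (hab : G.Adj a b)
    (hbc : G.Adj b c) (hcd : G.Adj c d) (hda : G.Adj d a) (e : G.edgeSet) :
    e ∈ cycleEdges hab hbc hcd hda ↔
      ∀ v ∈ e.1, v = a ∨ v = b ∨ v = c ∨ v = d := by
  obtain ⟨f⟩ := hG
  have key : ∀ u v w, G.Adj u v → G.Adj v w → ¬ G.Adj u w := by
    intro u v w h1 h2 h3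
    have h1 : f u ≠ f v := f.map_rel h1
    have h2 : f v ≠ f w := f.map_rel h2
    have h3 : f u ≠ f w := f.map_rel h3
    omega
  obtain ⟨u, v, he, rfl⟩ := exists_edgeOf e
  have hne := he.ne
  have h1 := key _ _ _ hab hbc
  have h2 := key _ _ _ hbc hcd
  simp only [cycleEdges, Finset.mem_insert, Finset.mem_singleton, edgeOf_eq_iff]
  simp only [edgeOf, Sym2.eq_iff, Sym2.mem_iff, forall_eq_or_imp, forall_eq]
  constructor
  · rintro ((⟨rfl, rfl⟩ | ⟨rfl, rfl⟩) | (⟨rfl, rfl⟩ | ⟨rfl, rfl⟩) | (⟨rfl, rfl⟩ | ⟨rfl, rfl⟩) |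
      (⟨rfl, rfl⟩ | ⟨rfl, rfl⟩)) <;> simp
  · rintro ⟨rfl | rfl | rfl | rfl, rfl | rfl | rfl | rfl⟩ <;>
      first
      | exact absurd rfl hne
      | exact absurd he h1
      | exact absurd he.symm h1
      | exact absurd he h2
      | exact absurd he.symm h2
      | simp

namespace Chromotopology

theorem boundary_comp_boundary (A : Chromotopology n V) : A.boundary₁ ∘ₗ A.boundary₂ = 0 := by
  have two : ∀ c : V →₀ ZMod 2, c + c = 0 := fun c => by
    ext v
    simpa using CharTwo.add_self_eq_zero (c v)
  have edge : ∀ {u v : V} (h : A.graph.Adj u v),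
      A.boundary₁ (Finsupp.single (edgeOf h) 1) = Finsupp.single u 1 + Finsupp.single v 1 := by
    intro u v h
    simp [boundary₁, edgeOf, Sym2.toFinset_mk_eq, Finset.sum_pair h.ne]
  refine Finsupp.lhom_ext' fun C => LinearMap.ext_ring ?_
  obtain ⟨C, ⟨a, b, c, d, hab, hbc, hcd, hda, hac, hbd, rfl⟩, hcard⟩ := C
  have ne : ∀ {x y z w : V} (h : A.graph.Adj x y) (h' : A.graph.Adj z w),
      ¬ (x = z ∧ y = w) → ¬ (x = w ∧ y = z) → edgeOf h ≠ edgeOf h' := by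
    intro x y z w h h' h1 h2 he
    have he' : s(x, y) = s(z, w) := congrArg Subtype.val he
    rw [Sym2.eq_iff] at he'
    tauto
  have n1 : edgeOf hab ≠ edgeOf hbc := ne _ _ (fun h => hab.ne h.1) (fun h => hac h.1)
  have n2 : edgeOf hab ≠ edgeOf hcd := ne _ _ (fun h => hac h.1) (fun h => hbc.ne h.2)
  have n3 : edgeOf hab ≠ edgeOf hda := ne _ _ (fun h => hda.ne h.1.symm) (fun h => hbd h.2)
  have n4 : edgeOf hbc ≠ edgeOf hcd := ne _ _ (fun h => hbc.ne h.1) (fun h => hbd h.1)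
  have n5 : edgeOf hbc ≠ edgeOf hda := ne _ _ (fun h => hbd h.1) (fun h => hab.ne h.1.symm)
  have n6 : edgeOf hcd ≠ edgeOf hda := ne _ _ (fun h => hcd.ne h.1) (fun h => hac h.1.symm)
  simp only [LinearMap.comp_apply, Finsupp.lsingle_apply, boundary₂,
    Finsupp.linearCombination_single, one_smul, LinearMap.zero_apply]
  rw [cycleEdges, Finset.sum_insert (by simp [n1, n2, n3]), Finset.sum_insert (by simp [n4, n5]),
    Finset.sum_pair n6, map_add, map_add, map_add, edge, edge, edge, edge]
  have ha := two (Finsupp.single a 1)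
  have hb := two (Finsupp.single b 1)
  have hc := two (Finsupp.single c 1)
  have hd := two (Finsupp.single d 1)
  calc _ = (Finsupp.single a (1 : ZMod 2) + Finsupp.single a 1)
        + (Finsupp.single b 1 + Finsupp.single b 1) + (Finsupp.single c 1 + Finsupp.single c 1)
        + (Finsupp.single d 1 + Finsupp.single d 1) := by abel
    _ = 0 := by rw [ha, hb, hc, hd]; simp

/-- The closed `1`-cell of an edge. -/
def edgeCell (A : Chromotopology n V) (e : A.Edge) : Set (V → ℝ) :=
  {w | ∃ u v : V, e.1 = s(u, v) ∧ ∃ t ∈ Set.Icc (0 : ℝ) 1,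
    w = (1 - t) • Pi.single u 1 + t • Pi.single v 1}

/-- The closed `2`-cell of a `2`-coloured `4`-cycle. -/
def faceCell (A : Chromotopology n V) (C : A.Face) : Set (V → ℝ) :=
  {w | ∃ (a b c d : V) (hab : A.graph.Adj a b) (hbc : A.graph.Adj b c) (hcd : A.graph.Adj c d)
    (hda : A.graph.Adj d a), a ≠ c ∧ b ≠ d ∧
    C.1 = cycleEdges hab hbc hcd hda ∧
    ∃ x ∈ Set.Icc (0 : ℝ) 1, ∃ y ∈ Set.Icc (0 : ℝ) 1, w = squarePoint a b c d x y}

/-- The open squares of distinct `2`-coloured `4`-cycles are disjoint. -/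
theorem faceCell_disjoint (A : Chromotopology n V) (C C' : A.Face) {a b c d a' b' c' d' : V}
    (hab : A.graph.Adj a b) (hbc : A.graph.Adj b c) (hcd : A.graph.Adj c d) (hda : A.graph.Adj d a)
    (hac : a ≠ c) (hbd : b ≠ d)
    (hC : C.1 = cycleEdges hab hbc hcd hda)
    (hab' : A.graph.Adj a' b') (hbc' : A.graph.Adj b' c') (hcd' : A.graph.Adj c' d')
    (hda' : A.graph.Adj d' a') (hac' : a' ≠ c') (hbd' : b' ≠ d')
    (hC' : C'.1 = cycleEdges hab' hbc' hcd' hda')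
    {x y x' y' : ℝ} (hx : x ∈ Set.Ioo (0 : ℝ) 1) (hy : y ∈ Set.Ioo (0 : ℝ) 1)
    (hx' : x' ∈ Set.Ioo (0 : ℝ) 1) (hy' : y' ∈ Set.Ioo (0 : ℝ) 1)
    (h : squarePoint a b c d x y = squarePoint a' b' c' d' x' y') : C = C' := by
  apply Subtype.ext
  rw [hC, hC']
  ext1 e
  rw [mem_fourCycle_iff A.bipartite, mem_fourCycle_iff A.bipartite]
  refine forall₂_congr fun v _ => ?_
  rw [← squarePoint_support hab.ne hac hda.ne.symm hbc.ne hbd hcd.ne hx hy v, h,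
    squarePoint_support hab'.ne hac' hda'.ne.symm hbc'.ne hbd' hcd'.ne hx' hy' v]

/-- The square `2`-complex `X(A)` as a topological space, with the subspace topology of `V → ℝ`.
As the graph is finite, simple and bipartite, the open cells are pairwise disjoint and the closed
cells are embedded (see `squarePoint_injective` and `faceCell_disjoint` below), so this is the
finite cell complex obtained from the graph of `A` by attaching one square along each
`2`-coloured `4`-cycle. -/
def Space (A : Chromotopology n V) : Type _ :=
  {w : V → ℝ // (∃ v, w ∈ vertexCell v) ∨ (∃ e, w ∈ A.edgeCell e) ∨ ∃ C, w ∈ A.faceCell C}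

instance (A : Chromotopology n V) : TopologicalSpace A.Space :=
  inferInstanceAs (TopologicalSpace {_w : V → ℝ // _})

/-- A subset of `V → ℝ`, such as a closed cell, seen as a subset of `X(A)`. -/
def inSpace (A : Chromotopology n V) (s : Set (V → ℝ)) : Set A.Space := {x | x.1 ∈ s}

end Chromotopology

/-! ### Colour-preserving maps and the maps of square complexes that they induce -/

/-- A map of vertices that sends edges to edges of the same colour. -/
structure ColorHom (A : Chromotopology n V) (B : Chromotopology n W) where
  toFun : V → W
  colorAdj : ∀ i u v, A.ColorAdj i u v → B.ColorAdj i (toFun u) (toFun v)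

/-- Push a weight function forward: the new weight of a point is the total weight of its fibre. -/
def pushWeights (f : V → W) (w : V → ℝ) : W → ℝ :=
  fun u => ∑ v ∈ Finset.univ.filter (fun v => f v = u), w v

theorem pushWeights_add (f : V → W) (w w' : V → ℝ) :
    pushWeights f (w + w') = pushWeights f w + pushWeights f w' := by
  funext u
  simp [pushWeights, Finset.sum_add_distrib]

theorem pushWeights_smul (f : V → W) (t : ℝ) (w : V → ℝ) :
    pushWeights f (t • w) = t • pushWeights f w := by
  funext u
  simp [pushWeights, Finset.mul_sum]

theorem pushWeights_single (f : V → W) (v : V) :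
    pushWeights f (Pi.single v (1 : ℝ)) = Pi.single (f v) 1 := by
  funext u
  simp [pushWeights, Finset.sum_pi_single', Pi.single_apply, Finset.sum_ite_eq', eq_comm (a := u)]

theorem pushWeights_id (w : V → ℝ) : pushWeights (fun v : V => v) w = w := by
  funext u
  simp [pushWeights, Finset.filter_eq']

theorem pushWeights_comp (g : W → U) (f : V → W) (w : V → ℝ) :
    pushWeights g (pushWeights f w) = pushWeights (fun v => g (f v)) w := by
  funext u
  simp only [pushWeights]
  rw [← Finset.sum_biUnion]
  · congr 1
    ext v
    simp
  · intro x _ y _ hxy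
    rw [Function.onFun, Finset.disjoint_left]
    intro v hv hv'
    simp only [Finset.mem_filter, Finset.mem_univ, true_and] at hv hv'
    exact hxy (hv.symm.trans hv')

theorem pushWeights_squarePoint (f : V → W) (a b c d : V) (x y : ℝ) :
    pushWeights f (squarePoint a b c d x y) = squarePoint (f a) (f b) (f c) (f d) x y := by
  simp only [squarePoint, pushWeights_add, pushWeights_smul, pushWeights_single]

theorem continuous_pushWeights (f : V → W) : Continuous (pushWeights f) := by
  unfold pushWeights
  fun_prop

namespace ColorHom

variable {A : Chromotopology n V} {B : Chromotopology n W}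

theorem adj (f : ColorHom A B) {u v : V} (h : A.graph.Adj u v) :
    B.graph.Adj (f.toFun u) (f.toFun v) :=
  (f.colorAdj _ u v ⟨h, rfl⟩).1

theorem color_eq (f : ColorHom A B) {u v : V} (h : A.graph.Adj u v) :
    B.color (edgeOf (f.adj h)) = A.color (edgeOf h) :=
  (f.colorAdj _ u v ⟨h, rfl⟩).2

/-- The induced map of edges. -/
def edgeMap (f : ColorHom A B) (e : A.Edge) : B.Edge :=
  ⟨Sym2.map f.toFun e.1, by
    obtain ⟨e, he⟩ := e
    induction e with
    | h u v => exact f.adj he⟩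

theorem color_edgeMap (f : ColorHom A B) (e : A.Edge) : B.color (f.edgeMap e) = A.color e := by
  obtain ⟨e, he⟩ := e
  induction e with
  | h u v => exact f.color_eq he

theorem map_ne (f : ColorHom A B) {a b c : V} (hab : A.graph.Adj a b) (hbc : A.graph.Adj b c)
    (hac : a ≠ c) : f.toFun a ≠ f.toFun c := by
  intro h
  have h1 := f.color_eq hab
  have h2 := f.color_eq hbc
  have h3 : ((edgeOf (f.adj hab)) : B.Edge) =
      (edgeOf (f.adj hbc)) := by
    rw [edgeOf_eq_iff]
    change s(f.toFun a, f.toFun b) = _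
    rw [h]
    exact Sym2.eq_swap
  rw [h3, h2] at h1
  have h4 := (A.existsUnique_edge b _).unique (y₁ := edgeOf hab) (y₂ := edgeOf hbc)
    ⟨by simp [edgeOf], rfl⟩ ⟨by simp [edgeOf], h1⟩
  have h5 : s(a, b) = s(b, c) := congrArg Subtype.val h4
  simp only [Sym2.eq_iff] at h5
  rcases h5 with ⟨h5, _⟩ | ⟨h5, _⟩
  · exact hab.ne h5
  · exact hac h5

theorem image_fourCycle (f : ColorHom A B) {a b c d : V} (hab : A.graph.Adj a b)
    (hbc : A.graph.Adj b c) (hcd : A.graph.Adj c d) (hda : A.graph.Adj d a) :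
    (cycleEdges hab hbc hcd hda).image
      f.edgeMap =
    cycleEdges (f.adj hab) (f.adj hbc) (f.adj hcd) (f.adj hda) := by
  simp only [cycleEdges, Finset.image_insert, Finset.image_singleton]
  rfl

/-- The induced map of `2`-coloured `4`-cycles: a cycle goes to the set of images of its edges. -/
def faceMap (f : ColorHom A B) (C : A.Face) : B.Face :=
  ⟨C.1.image f.edgeMap, by
    obtain ⟨C, ⟨a, b, c, d, hab, hbc, hcd, hda, hac, hbd, hC⟩, hcard⟩ := C
    refine ⟨⟨f.toFun a, f.toFun b, f.toFun c, f.toFun d, f.adj hab, f.adj hbc, f.adj hcd,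
      f.adj hda, f.map_ne hab hbc hac, f.map_ne hbc hcd hbd, ?_⟩, ?_⟩
    · subst hC
      exact f.image_fourCycle hab hbc hcd hda
    · rw [Finset.image_image]
      convert hcard using 3
      funext e
      exact f.color_edgeMap e⟩

/-- The induced continuous map of square complexes, which is affine on edges and bilinear on
squares. -/
def spaceMap (f : ColorHom A B) (x : A.Space) : B.Space :=
  ⟨pushWeights f.toFun x.1, by
    obtain ⟨w, ⟨v, hv⟩ | ⟨e, u, v, he, t, ht, hw⟩ | ⟨C, a, b, c, d, hab, hbc, hcd, hda, hac, hbd,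
      hC, x, hx, y, hy, hw⟩⟩ := x
    · refine Or.inl ⟨f.toFun v, ?_⟩
      have hv' : w = Pi.single v 1 := hv
      simp only [vertexCell, Set.mem_singleton_iff, hv', pushWeights_single]
    · refine Or.inr (Or.inl ⟨f.edgeMap e, f.toFun u, f.toFun v, ?_, t, ht, ?_⟩)
      · simp only [edgeMap, he, Sym2.map_mk]
      · simp only [hw, pushWeights_add, pushWeights_smul, pushWeights_single]
    · refine Or.inr (Or.inr ⟨f.faceMap C, f.toFun a, f.toFun b, f.toFun c, f.toFun d, f.adj hab,
        f.adj hbc, f.adj hcd, f.adj hda, f.map_ne hab hbc hac, f.map_ne hbc hcd hbd, ?_,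
        x, hx, y, hy, ?_⟩)
      · simp only [faceMap, hC]
        exact f.image_fourCycle hab hbc hcd hda
      · simp only [hw, pushWeights_squarePoint]⟩

theorem continuous_spaceMap (f : ColorHom A B) : Continuous f.spaceMap :=
  Continuous.subtype_mk ((continuous_pushWeights f.toFun).comp continuous_subtype_val) _

end ColorHom

end Defs

/-! ### The cubical chromotopology -/

section Cube

variable {n : ℕ}

/-- Two bitstrings are joined by an edge if they differ in exactly one bit. -/
def cubeGraph (n : ℕ) : SimpleGraph (Bits n) where
  Adj u v := ∃! i, u i ≠ v i
  symm := ⟨fun u v h => by simpa only [ne_comm] using h⟩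
  loopless := ⟨fun u h => by obtain ⟨i, hi, _⟩ := h; exact hi rfl⟩

theorem zmod_two_ne {a b : ZMod 2} (h : a ≠ b) : b = a + 1 := by
  revert a b
  decide

theorem cube_adj_iff {u v : Bits n} :
    (cubeGraph n).Adj u v ↔ ∃ i, v = u + Pi.single i 1 := by
  constructor
  · rintro ⟨i, hi, hu⟩
    refine ⟨i, ?_⟩
    funext j
    by_cases hj : j = i
    · subst hj
      simpa using zmod_two_ne hi
    · simp only [Pi.add_apply, Pi.single_apply, hj, if_false, add_zero]
      by_contra h
      exact hj (hu j (Ne.symm h))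
  · rintro ⟨i, rfl⟩
    refine ⟨i, by simp, fun j hj => ?_⟩
    by_contra h
    simp [Pi.single_apply, h] at hj

theorem exists_cubeColor (e : (cubeGraph n).edgeSet) :
    ∃ i, ∃ u v : Bits n, e.1 = s(u, v) ∧ u i ≠ v i := by
  obtain ⟨e, he⟩ := e
  induction e with
  | h u v =>
    obtain ⟨i, hi, _⟩ := he
    exact ⟨i, u, v, rfl, hi⟩

/-- The colour of an edge of the cube is the bit in which its endpoints differ. -/
def cubeColor (e : (cubeGraph n).edgeSet) : Fin n := (exists_cubeColor e).choose

theorem cubeColor_eq {u v : Bits n} (h : (cubeGraph n).Adj u v) (i : Fin n) :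
    cubeColor (edgeOf h) = i ↔ v = u + Pi.single i 1 := by
  have key : u (cubeColor (edgeOf h)) ≠ v (cubeColor (edgeOf h)) := by
    obtain ⟨u', v', he, hne⟩ := (exists_cubeColor (edgeOf h)).choose_spec
    change s(u, v) = _ at he
    simp only [Sym2.eq_iff] at he
    rcases he with ⟨rfl, rfl⟩ | ⟨rfl, rfl⟩
    · exact hne
    · exact hne.symm
  constructor
  · rintro rfl
    obtain ⟨j, rfl⟩ := cube_adj_iff.1 h
    by_cases hj : cubeColor (edgeOf h) = j
    · rw [hj]
    · simp [Pi.single_apply, hj] at key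
  · rintro rfl
    by_contra hj
    simp [Pi.single_apply, hj] at key

theorem cube_add_add (u : Bits n) (i : Fin n) : u + Pi.single i 1 + Pi.single i 1 = u := by
  rw [add_assoc, ← Pi.single_add]
  simp [show (1 + 1 : ZMod 2) = 0 from by decide]

theorem cube_adj (u : Bits n) (i : Fin n) : (cubeGraph n).Adj u (u + Pi.single i 1) :=
  cube_adj_iff.2 ⟨i, rfl⟩

theorem cube_connected : (cubeGraph n).Connected := by
  have key : ∀ (s : Finset (Fin n)) (u : Bits n),
      (cubeGraph n).Reachable u (u + ∑ i ∈ s, Pi.single i 1) := by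
    intro s
    induction s using Finset.induction_on with
    | empty =>
      intro u
      simp
    | insert i s hi ih =>
      intro u
      rw [Finset.sum_insert hi, ← add_assoc]
      exact (cube_adj u i).reachable.trans (ih _)
  refine ⟨fun u v => ?_⟩
  convert key (Finset.univ.filter fun i => u i ≠ v i) u using 1
  funext j
  rw [Pi.add_apply, Finset.sum_apply]
  by_cases hj : u j = v j
  · simp [Pi.single_apply, hj]
  · simpa [Pi.single_apply, hj] using zmod_two_ne hj

theorem cube_bipartite : (cubeGraph n).IsBipartite := by
  refine ⟨SimpleGraph.Coloring.mk (fun u : Bits n => (∑ i, u i : ZMod 2)) ?_⟩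
  intro u v h
  obtain ⟨i, rfl⟩ := cube_adj_iff.1 h
  have h01 : ∀ a : ZMod 2, a ≠ a + 1 := by decide
  simp only [Pi.add_apply, Finset.sum_add_distrib, Finset.sum_pi_single', Finset.mem_univ, if_true]
  exact h01 _

theorem cube_single_injective (u : Bits n) :
    Function.Injective fun i : Fin n => u + Pi.single i 1 := by
  intro i j h
  have h' := congrFun h i
  by_contra hij
  simp [Pi.single_apply, hij] at h'

theorem cube_regular (u : Bits n) : ((cubeGraph n).neighborSet u).ncard = n := by
  have h : (cubeGraph n).neighborSet u = Set.range fun i : Fin n => u + Pi.single i 1 := by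
    ext v
    rw [SimpleGraph.mem_neighborSet, cube_adj_iff]
    simp only [Set.mem_range, eq_comm]
  rw [h, Set.ncard_range_of_injective (cube_single_injective u)]
  simp

theorem cube_existsUnique_edge (v : Bits n) (i : Fin n) :
    ∃! e : (cubeGraph n).edgeSet, v ∈ e.1 ∧ cubeColor e = i := by
  refine ⟨edgeOf (cube_adj v i), ⟨by simp [edgeOf], (cubeColor_eq _ _).2 rfl⟩, ?_⟩
  rintro e ⟨hv, he⟩
  obtain ⟨a, b, h, rfl⟩ := exists_edgeOf e
  rw [cubeColor_eq] at he
  subst he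
  rw [edgeOf_eq_iff]
  simp only [edgeOf, Sym2.mem_iff] at hv ⊢
  rcases hv with rfl | rfl
  · rfl
  · rw [cube_add_add]
    exact Sym2.eq_swap

/-- The `4`-cycle of the cube through `v` that uses the colours `i` and `j`. -/
def cubeSquare (v : Bits n) (i j : Fin n) : Finset (cubeGraph n).edgeSet :=
  cycleEdges (cube_adj v i) (cube_adj (v + Pi.single i 1) j)
    (show (cubeGraph n).Adj _ (v + Pi.single j 1) from
      cube_adj_iff.2 ⟨i, by rw [add_right_comm v, cube_add_add]⟩)
    (cube_adj v j).symm

theorem mem_cubeSquare (v : Bits n) (i j : Fin n) (e : (cubeGraph n).edgeSet) :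
    e ∈ cubeSquare v i j ↔ e.1 = s(v, v + Pi.single i 1) ∨
      e.1 = s(v + Pi.single i 1, v + Pi.single i 1 + Pi.single j 1) ∨
      e.1 = s(v + Pi.single i 1 + Pi.single j 1, v + Pi.single j 1) ∨
      e.1 = s(v + Pi.single j 1, v) := by
  simp only [cubeSquare, cycleEdges, Finset.mem_insert, Finset.mem_singleton, edgeOf_eq_iff]

theorem cubeSquare_add_left (v : Bits n) (i j : Fin n) :
    cubeSquare (v + Pi.single i 1) i j = cubeSquare v i j := by
  ext e
  rw [mem_cubeSquare, mem_cubeSquare, cube_add_add, Sym2.eq_swap (a := v + Pi.single i 1) (b := v),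
    Sym2.eq_swap (a := v + Pi.single i 1 + Pi.single j 1) (b := v + Pi.single j 1),
    Sym2.eq_swap (a := v + Pi.single i 1 + Pi.single j 1) (b := v + Pi.single i 1),
    Sym2.eq_swap (a := v + Pi.single j 1) (b := v)]
  tauto

theorem cubeSquare_add_right (v : Bits n) (i j : Fin n) :
    cubeSquare (v + Pi.single j 1) i j = cubeSquare v i j := by
  ext e
  rw [mem_cubeSquare, mem_cubeSquare, add_right_comm v (Pi.single j 1), cube_add_add,
    cube_add_add,
    Sym2.eq_swap (a := v + Pi.single j 1) (b := v + Pi.single i 1 + Pi.single j 1),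
    Sym2.eq_swap (a := v + Pi.single i 1 + Pi.single j 1) (b := v + Pi.single i 1),
    Sym2.eq_swap (a := v + Pi.single i 1) (b := v),
    Sym2.eq_swap (a := v) (b := v + Pi.single j 1)]
  tauto

theorem cubeSquare_eq_of_mem {u v : Bits n} {i j : Fin n} {e : (cubeGraph n).edgeSet}
    (he : e ∈ cubeSquare v i j) (hu : u ∈ e.1) : cubeSquare u i j = cubeSquare v i j := by
  rw [mem_cubeSquare] at he
  rcases he with he | he | he | he <;> rw [he, Sym2.mem_iff] at hu <;>
    rcases hu with rfl | rfl <;> simp only [cubeSquare_add_left, cubeSquare_add_right]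

theorem cube_fourCycles (i j : Fin n) (hij : i ≠ j) :
    ∃ S : Set (Finset (cubeGraph n).edgeSet),
      (∀ C ∈ S, IsFourCycle (cubeGraph n) C) ∧
      (∀ C ∈ S, ∀ C' ∈ S, C ≠ C' → ∀ e ∈ C, ∀ e' ∈ C', ∀ v ∈ e.1, v ∉ e'.1) ∧
      ∀ e : (cubeGraph n).edgeSet, (cubeColor e = i ∨ cubeColor e = j) ↔ ∃ C ∈ S, e ∈ C := by
  refine ⟨Set.range fun v => cubeSquare v i j, ?_, ?_, ?_⟩
  · rintro _ ⟨v, rfl⟩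
    refine ⟨_, _, _, _, _, _, _, _, ?_, ?_, rfl⟩
    · intro h
      have h' := congrFun h i
      simp [Pi.single_apply, hij] at h'
    · intro h
      exact hij (cube_single_injective v h)
  · rintro _ ⟨v, rfl⟩ _ ⟨w, rfl⟩ hne e he e' he' u hu hu'
    exact hne ((cubeSquare_eq_of_mem he hu).symm.trans (cubeSquare_eq_of_mem he' hu'))
  · intro e
    constructor
    · intro h
      obtain ⟨a, b, hab, rfl⟩ := exists_edgeOf e
      rw [cubeColor_eq, cubeColor_eq] at h
      refine ⟨_, ⟨a, rfl⟩, ?_⟩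
      rw [mem_cubeSquare]
      rcases h with rfl | rfl
      · exact Or.inl rfl
      · exact Or.inr (Or.inr (Or.inr Sym2.eq_swap))
    · rintro ⟨_, ⟨v, rfl⟩, he⟩
      simp only [cubeSquare, cycleEdges, Finset.mem_insert, Finset.mem_singleton] at he
      rcases he with rfl | rfl | rfl | rfl <;> rw [cubeColor_eq, cubeColor_eq]
      · exact Or.inl rfl
      · exact Or.inr rfl
      · left
        rw [add_right_comm v, cube_add_add]
      · right
        rw [cube_add_add]

/-- The cubical chromotopology `I^n_c`. -/
def cube (n : ℕ) : Chromotopology n (Bits n) where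
  graph := cubeGraph n
  connected := cube_connected
  bipartite := cube_bipartite
  regular := cube_regular
  color := cubeColor
  existsUnique_edge := cube_existsUnique_edge
  fourCycles := cube_fourCycles

theorem cube_colorAdj_iff {i : Fin n} {u v : Bits n} :
    (cube n).ColorAdj i u v ↔ v = u + Pi.single i 1 := by
  constructor
  · rintro ⟨h, hc⟩
    exact (cubeColor_eq h i).1 hc
  · intro h
    exact ⟨cube_adj_iff.2 ⟨i, h⟩, (cubeColor_eq _ i).2 h⟩

/-! ### Bitstrings act on the cube and on its square complex by translation -/

/-- Translation by a bitstring, as a colour-preserving map of the cube. -/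
def translate (s : Bits n) : ColorHom (cube n) (cube n) where
  toFun v := s + v
  colorAdj i u v h := by
    rw [cube_colorAdj_iff] at h ⊢
    rw [h, add_assoc]

instance : AddAction (Bits n) (cube n).Edge where
  vadd s e := (translate s).edgeMap e
  zero_vadd e := by
    obtain ⟨u, v, h, rfl⟩ := exists_edgeOf e
    rw [edgeOf_eq_iff]
    change s(0 + u, 0 + v) = _
    simp
  add_vadd s t e := by
    obtain ⟨u, v, h, rfl⟩ := exists_edgeOf e
    apply Subtype.ext
    change s(s + t + u, s + t + v) = s(s + (t + u), s + (t + v))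
    simp only [add_assoc]

instance : AddAction (Bits n) (cube n).Face where
  vadd s C := (translate s).faceMap C
  zero_vadd C := by
    apply Subtype.ext
    change C.1.image (fun e => (0 : Bits n) +ᵥ e) = C.1
    simp
  add_vadd s t C := by
    apply Subtype.ext
    change C.1.image (fun e => (s + t) +ᵥ e) =
      (C.1.image (fun e => t +ᵥ e)).image (fun e => s +ᵥ e)
    rw [Finset.image_image]
    simp only [add_vadd, Function.comp_def]

instance : AddAction (Bits n) (cube n).Space where
  vadd s x := (translate s).spaceMap x
  zero_vadd x := by
    apply Subtype.ext
    change pushWeights (fun v : Bits n => 0 + v) x.1 = x.1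
    simp only [zero_add, pushWeights_id]
  add_vadd s t x := by
    apply Subtype.ext
    change pushWeights (fun v : Bits n => s + t + v) x.1 =
      pushWeights (fun v : Bits n => s + v) (pushWeights (fun v : Bits n => t + v) x.1)
    simp only [pushWeights_comp, add_assoc]

end Cube

/-! ### Quotients of the cube by a code -/

section Code

variable {n : ℕ} {V : Type*} [Fintype V] [DecidableEq V]

/-- In the graph quotient `I^n_c / L` there is an edge of colour `i` between two classes if there is
an edge of colour `i` of the cube between some representatives of them. -/
def QuotientColorAdj (L : Submodule (ZMod 2) (Bits n)) (i : Fin n) (x y : Bits n ⧸ L) : Prop :=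
  ∃ u v : Bits n, L.mkQ u = x ∧ L.mkQ v = y ∧ (cube n).ColorAdj i u v

/-- An identification of `I^n_c / L` with `A`: a bijection of vertices under which the coloured
edges correspond. -/
structure CodeLabelling (A : Chromotopology n V) (L : Submodule (ZMod 2) (Bits n)) where
  toEquiv : (Bits n ⧸ L) ≃ V
  colorAdj_iff : ∀ i x y, QuotientColorAdj L i x y ↔ A.ColorAdj i (toEquiv x) (toEquiv y)

/-- The quotient map `I^n_c → I^n_c / L = A`. -/
def CodeLabelling.proj {A : Chromotopology n V} {L : Submodule (ZMod 2) (Bits n)}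
    (φ : CodeLabelling A L) : ColorHom (cube n) A where
  toFun v := φ.toEquiv (L.mkQ v)
  colorAdj i u v h := (φ.colorAdj_iff i _ _).1 ⟨u, v, rfl, rfl, h⟩

/-- The code `L` acts freely on the set or space `X`. -/
def ActsFreely (L : Submodule (ZMod 2) (Bits n)) (X : Type*) [AddAction (Bits n) X] : Prop :=
  ∀ (l : L) (x : X), l +ᵥ x = x → l = 0

/-- The map `f` identifies `Y` with the set of orbits of `L` on `X`. -/
def IsOrbitMap (L : Submodule (ZMod 2) (Bits n)) {X Y : Type*} [AddAction (Bits n) X]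
    (f : X → Y) : Prop :=
  Function.Surjective f ∧ ∀ x x' : X, f x = f x' ↔ ∃ l : L, l +ᵥ x = x'

/-- The map induced on chains by a map of cells. -/
def chainMap {X Y : Type*} (f : X → Y) : (X →₀ ZMod 2) →ₗ[ZMod 2] (Y →₀ ZMod 2) :=
  Finsupp.lmapDomain (ZMod 2) (ZMod 2) f

/-- The chains that become zero in the quotient by `L`: those spanned by the differences of a cell
and its translates. -/
def orbitRelations (L : Submodule (ZMod 2) (Bits n)) (X : Type*) [AddAction (Bits n) X] :
    Submodule (ZMod 2) (X →₀ ZMod 2) :=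
  Submodule.span (ZMod 2)
    {c | ∃ (l : L) (x : X), c = Finsupp.single (l +ᵥ x) 1 - Finsupp.single x 1}

/-- The map `f` of vertices exhibits the cell complex `X(A)` as the quotient complex `X(I^n_c) / L`:
in each dimension the cells of `X(A)` are the orbits of cells of `X(I^n_c)`, the chain complex of
`X(A)` is the quotient of that of `X(I^n_c)`, the space `X(A)` is homeomorphic to the orbit space,
and each closed cell is mapped onto the corresponding closed cell. -/
structure IsQuotientComplex {A : Chromotopology n V} (L : Submodule (ZMod 2) (Bits n))
    (f : ColorHom (cube n) A) : Prop where
  vertices : IsOrbitMap L f.toFun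
  edges : IsOrbitMap L f.edgeMap
  faces : IsOrbitMap L f.faceMap
  boundary₁_comm : chainMap f.toFun ∘ₗ (cube n).boundary₁ = A.boundary₁ ∘ₗ chainMap f.edgeMap
  boundary₂_comm : chainMap f.edgeMap ∘ₗ (cube n).boundary₂ = A.boundary₂ ∘ₗ chainMap f.faceMap
  chains₀ : LinearMap.range (chainMap f.toFun) = ⊤ ∧
    LinearMap.ker (chainMap f.toFun) = orbitRelations L (Bits n)
  chains₁ : LinearMap.range (chainMap f.edgeMap) = ⊤ ∧
    LinearMap.ker (chainMap f.edgeMap) = orbitRelations L (cube n).Edge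
  chains₂ : LinearMap.range (chainMap f.faceMap) = ⊤ ∧
    LinearMap.ker (chainMap f.faceMap) = orbitRelations L (cube n).Face
  homeomorph : ∃ h : Quotient (AddAction.orbitRel L (cube n).Space) ≃ₜ A.Space,
    ∀ x : (cube n).Space, h (Quotient.mk _ x) = f.spaceMap x
  vertexCell_image : ∀ v : Bits n,
    f.spaceMap '' (cube n).inSpace (vertexCell v) = A.inSpace (vertexCell (f.toFun v))
  edgeCell_image : ∀ e : (cube n).Edge,
    f.spaceMap '' (cube n).inSpace ((cube n).edgeCell e) = A.inSpace (A.edgeCell (f.edgeMap e))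
  faceCell_image : ∀ C : (cube n).Face,
    f.spaceMap '' (cube n).inSpace ((cube n).faceCell C) = A.inSpace (A.faceCell (f.faceMap C))

end Code

/-- The group of deck transformations of `π : X → Y`: the homeomorphisms of `X` over `Y`. -/
def deckGroup {X Y : Type*} [TopologicalSpace X] [TopologicalSpace Y] (π : X → Y) :
    Subgroup (X ≃ₜ X) where
  carrier := {h | ∀ x, π (h x) = π x}
  mul_mem' {g h} hg hh x := by
    change π (g (h x)) = π x
    rw [hg, hh]
  one_mem' x := rfl
  inv_mem' {h} hh x := by
    change π (h.symm x) = π x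
    rw [← hh (h.symm x), h.apply_symm_apply]

end Adinkra

end

/-! Following the edge of colour `i` is an involution of the vertices of `A`, and the 4-cycle
condition says that these involutions commute (`nbr_comm`). They generate an action of the
bitstrings on the vertices, transitive because `A` is connected. An orbit map of this action is a
colour-preserving map from the cube to `A`, its fibres are the cosets of the stabiliser `L`, and so
`A` is the cube modulo `L`. Since the group is commutative, all vertices have the same stabiliser;
conversely every labelling by a code yields a colour-preserving map with that code. This gives
uniqueness.

The geometry rests on one fact, `eq_zero_of_card_le`: a nonzero word of `L` has weight at least 4,
because a word of weight 1, 2 or 3 would give a loop, a double edge or a triangle in `A`. Edges and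
faces are determined by their colours and any one corner, so equality of images downstairs becomes a
translation by `L` upstairs. A translation preserving a cell of dimension at most 2 moves a corner
to a corner and has weight at most 2, hence is trivial.

For points, the complex of the cube is identified with the 2-skeleton of the solid cube by
multilinear weights (`cubeSpaceHomeomorph`). If two points have the same image, a translation by `L`
makes their supports share a vertex. Comparing the supports involves words of weight at most 2 + 1 =
3, so the supports agree, the projection is injective on them, and the points coincide
(`isOrbitMap_spaceMap`). The fibres of the projection are thus the orbits of a free action of a
finite group on a compact Hausdorff space, which gives the orbit space and the covering.

Simple connectedness is proved by induction on the number of free coordinates: the ends of the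
skeleton in the new direction contract to a smaller skeleton, and their overlap is path connected,
so the Seifert–van Kampen argument applies. Finally, a deck transformation agrees with some
translation at one point, hence everywhere by uniqueness of lifts. -/

/-! ### Homotopy of paths and unions of simply connected open sets. -/

theorem Path.homotopic_of_range_subset {X : Type*} [TopologicalSpace X] {S : Set X}
    [SimplyConnectedSpace S] {x y : X} (p q : Path x y) (hp : Set.range p ⊆ S)
    (hq : Set.range q ⊆ S) : p.Homotopic q := by
  have hx : x ∈ S := hp ⟨0, p.source⟩
  have hy : y ∈ S := hp ⟨1, p.target⟩
  let lift (r : Path x y) (hr : Set.range r ⊆ S) : Path (⟨x, hx⟩ : S) ⟨y, hy⟩ :=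
    { toFun := fun t => ⟨r t, hr ⟨t, rfl⟩⟩
      source' := by simp
      target' := by simp }
  obtain ⟨F⟩ := SimplyConnectedSpace.paths_homotopic (lift p hp) (lift q hq)
  exact ⟨F.map ⟨Subtype.val, continuous_subtype_val⟩⟩

/-- The simply connected case of the theorem of Seifert and van Kampen. -/
theorem SimplyConnectedSpace.of_union {X : Type*} [TopologicalSpace X] {U V : Set X}
    (hU : IsOpen U) (hV : IsOpen V) (hUV : U ∪ V = Set.univ) [SimplyConnectedSpace U]
    [SimplyConnectedSpace V] (hI : IsPathConnected (U ∩ V)) : SimplyConnectedSpace X := by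
  obtain ⟨x₀, hx₀, hjoin⟩ := hI
  have joined : ∀ {S : Set X} [SimplyConnectedSpace S], x₀ ∈ S → ∀ x ∈ S, JoinedIn S x₀ x := by
    intro S _ h0 x hx
    exact (isPathConnected_iff_pathConnectedSpace.2 inferInstance).joinedIn _ h0 _ hx
  -- Reference paths from the base point that stay in every member of the cover containing their
  -- endpoint; for endpoints in both members this uses path connectedness of the intersection.
  have hc : ∀ x, ∃ c : Path x₀ x, (x ∈ U → Set.range c ⊆ U) ∧ (x ∈ V → Set.range c ⊆ V) := by
    intro x
    by_cases hxU : x ∈ U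
    · by_cases hxV : x ∈ V
      · obtain ⟨c, hc⟩ := hjoin ⟨hxU, hxV⟩
        exact ⟨c, fun _ => Set.range_subset_iff.2 fun t => (hc t).1,
          fun _ => Set.range_subset_iff.2 fun t => (hc t).2⟩
      · obtain ⟨c, hc⟩ := joined hx₀.1 x hxU
        exact ⟨c, fun _ => Set.range_subset_iff.2 hc, fun h => absurd h hxV⟩
    · have hxV : x ∈ V := (hUV.symm ▸ Set.mem_univ x : x ∈ U ∪ V).resolve_left hxU
      obtain ⟨c, hc⟩ := joined hx₀.2 x hxV
      exact ⟨c, fun h => absurd h hxU, fun _ => Set.range_subset_iff.2 hc⟩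
  choose c hcU hcV using hc
  have step : ∀ {x y : X} (γ : Path x y), Set.range γ ⊆ U ∨ Set.range γ ⊆ V →
      ((c x).trans γ).Homotopic (c y) := by
    rintro x y γ (h | h)
    · have hx := h ⟨0, γ.source⟩
      have hy := h ⟨1, γ.target⟩
      refine Path.homotopic_of_range_subset (S := U) _ _ ?_ (hcU y hy)
      rw [Path.trans_range]
      exact Set.union_subset (hcU x hx) h
    · have hx := h ⟨0, γ.source⟩
      have hy := h ⟨1, γ.target⟩
      refine Path.homotopic_of_range_subset (S := V) _ _ ?_ (hcV y hy)
      rw [Path.trans_range]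
      exact Set.union_subset (hcV x hx) h
  -- Subdivide the path so that each piece lies in `U` or in `V`, and absorb the pieces into the
  -- reference path one by one with `step`.
  have main : ∀ {x y : X} (γ : Path x y), ((c x).trans γ).Homotopic (c y) := by
    intro x y γ
    obtain ⟨t, ht0, htm, ⟨N, hN⟩, hsub⟩ := exists_monotone_Icc_subset_open_cover_unitInterval
      (c := fun b : Bool => γ ⁻¹' (if b then U else V))
      (fun b => by
        cases b
        · simpa using hV.preimage γ.continuous
        · simpa using hU.preimage γ.continuous)
      (fun s _ => by
        rcases (hUV.symm ▸ Set.mem_univ (γ s) : γ s ∈ U ∪ V) with h | h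
        · exact Set.mem_iUnion.2 ⟨true, by simpa using h⟩
        · exact Set.mem_iUnion.2 ⟨false, by simpa using h⟩)
    have key : ∀ k, ((c (γ (t 0))).trans (γ.subpath (t 0) (t k))).Homotopic (c (γ (t k))) := by
      intro k
      induction k with
      | zero =>
        rw [Path.subpath_self]
        exact ⟨Path.Homotopy.transRefl _⟩
      | succ k ih =>
        have h1 : (γ.subpath (t 0) (t (k + 1))).Homotopic
            ((γ.subpath (t 0) (t k)).trans (γ.subpath (t k) (t (k + 1)))) :=
          ⟨(Path.Homotopy.subpathTransSubpath γ _ _ _).symm⟩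
        have h2 : Set.range (γ.subpath (t k) (t (k + 1))) ⊆ U ∨
            Set.range (γ.subpath (t k) (t (k + 1))) ⊆ V := by
          rw [Path.range_subpath_of_le _ _ _ (htm (Nat.le_succ k))]
          obtain ⟨b, hb⟩ := hsub k
          cases b
          · exact Or.inr (Set.image_subset_iff.2 (by simpa using hb))
          · exact Or.inl (Set.image_subset_iff.2 (by simpa using hb))
        refine ((Path.Homotopic.refl _).hcomp h1).trans ?_
        refine Path.Homotopic.trans ⟨(Path.Homotopy.transAssoc _ _ _).symm⟩ ?_
        exact (ih.hcomp (Path.Homotopic.refl _)).trans (step _ h2)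
    have h := key N
    rw [ht0, hN N le_rfl, Path.subpath_zero_one] at h
    -- The full subpath of `γ` runs from `γ 0` to `γ 1`, which equal `x` and `y` only
    -- propositionally.
    have uncast : ∀ {x' y' : X} (hx : x' = x) (hy : y' = y),
        ((c x').trans (γ.cast hx hy)).Homotopic (c y') → ((c x).trans γ).Homotopic (c y) := by
      rintro x' y' rfl rfl h
      exact h
    exact uncast _ _ h
  rw [simply_connected_iff_paths_homotopic']
  refine ⟨⟨⟨x₀⟩, fun x y => ⟨(c x).symm.trans (c y)⟩⟩, fun {x y} p q => ?_⟩
  -- After prefixing `c x`, both paths become homotopic to `c y`; it remains to cancel the prefix.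
  have h := (main p).trans (main q).symm
  have cancel : ∀ r : Path x y, r.Homotopic ((c x).symm.trans ((c x).trans r)) := fun r =>
    Path.Homotopic.trans ⟨(Path.Homotopy.reflTrans r).symm⟩
      (Path.Homotopic.trans (Path.Homotopic.hcomp ⟨Path.Homotopy.reflSymmTrans (c x)⟩
        (Path.Homotopic.refl r)) ⟨Path.Homotopy.transAssoc _ _ _⟩)
  exact (cancel p).trans (((Path.Homotopic.refl _).hcomp h).trans (cancel q).symm)

noncomputable section
namespace Adinkra

/-! ### Simple connectedness of the 2-skeleton of a solid cube. -/

section Skeleton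

variable {ι : Type*} [Fintype ι] [DecidableEq ι]

/-- The coordinates of `p` other than `0` and `1`. -/
def fracCoords (p : ι → ℝ) : Finset ι := Finset.univ.filter fun i => p i ≠ 0 ∧ p i ≠ 1

theorem mem_fracCoords {p : ι → ℝ} {i : ι} : i ∈ fracCoords p ↔ p i ≠ 0 ∧ p i ≠ 1 := by
  simp [fracCoords]

/-- The `k`-skeleton of the face of the unit cube on which the coordinates outside `J` vanish. -/
def cubeSkeleton (k : ℕ) (J : Finset ι) : Set (ι → ℝ) :=
  {p | (∀ i, p i ∈ Set.Icc (0 : ℝ) 1) ∧ (∀ i ∉ J, p i = 0) ∧ (fracCoords p).card ≤ k}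

theorem fracCoords_update_subset (p : ι → ℝ) (i : ι) (t : ℝ) :
    fracCoords (Function.update p i t) ⊆ insert i (fracCoords p) := by
  intro j hj
  rw [mem_fracCoords] at hj
  by_cases h : j = i
  · exact Finset.mem_insert.2 (Or.inl h)
  · rw [Function.update_of_ne h] at hj
    exact Finset.mem_insert_of_mem (mem_fracCoords.2 hj)

/-- An update creates a new fractional coordinate only by moving an integral coordinate off 0 and 1.
-/
theorem fracCoords_update_subset_of_imp {p : ι → ℝ} {i : ι} {t : ℝ}
    (h : p i = 0 ∨ p i = 1 → t = 0 ∨ t = 1) :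
    fracCoords (Function.update p i t) ⊆ fracCoords p := by
  intro j hj
  rw [mem_fracCoords] at hj ⊢
  by_cases hji : j = i
  · subst hji
    rw [Function.update_self] at hj
    tauto
  · rwa [Function.update_of_ne hji] at hj

/-- The face may change from `J` to `J'`, so that one lemma serves for moving inside a face,
projecting to a smaller face and including into a larger one. -/
theorem update_mem_cubeSkeleton {k : ℕ} {J J' : Finset ι} {p : ι → ℝ} {i : ι} {t : ℝ}
    (hp : p ∈ cubeSkeleton k J) (hJ : ∀ j ∉ J', j ≠ i → j ∉ J) (ht : t ∈ Set.Icc (0 : ℝ) 1)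
    (hi : i ∈ J' ∨ t = 0) (hcard : (fracCoords (Function.update p i t)).card ≤ k) :
    Function.update p i t ∈ cubeSkeleton k J' := by
  refine ⟨fun j => ?_, fun j hj => ?_, hcard⟩
  · by_cases h : j = i
    · subst h
      rwa [Function.update_self]
    · rw [Function.update_of_ne h]
      exact hp.1 j
  · by_cases h : j = i
    · subst h
      rw [Function.update_self]
      exact hi.resolve_left hj
    · rw [Function.update_of_ne h]
      exact hp.2.1 j (hJ j hj h)

theorem combo_update (p : ι → ℝ) (i : ι) (t : ℝ) {a b : ℝ} (hab : a + b = 1) :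
    a • p + b • Function.update p i t = Function.update p i (a * p i + b * t) := by
  funext j
  by_cases h : j = i
  · subst h
    simp
  · simp only [Pi.add_apply, Pi.smul_apply, Function.update_of_ne h, smul_eq_mul]
    rw [← add_mul, hab, one_mul]

/-- The part of the `2`-skeleton near the middle of the coordinate `j`. -/
def middleBand (J : Finset ι) (j : ι) : Set (ι → ℝ) :=
  {p | p ∈ cubeSkeleton 2 (insert j J) ∧ 1 / 3 < p j ∧ p j < 2 / 3}

/-- On the band the coordinate `j` is fractional, so at most one other coordinate is: the band is an
open interval times a 1-skeleton. Every point is joined to the centre of the edge at the origin in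
direction `j` by sending the other coordinates to 0 one at a time. -/
theorem isPathConnected_middleBand (J : Finset ι) (j : ι) :
    IsPathConnected (middleBand J j) := by
  have frac_j : ∀ p ∈ middleBand J j, j ∈ fracCoords p := by
    rintro p ⟨-, h1, h2⟩
    rw [mem_fracCoords]
    constructor <;> linarith
  have hb : Function.update (0 : ι → ℝ) j (1 / 2) ∈ middleBand J j := by
    refine ⟨⟨fun i => ?_, fun i hi => ?_, ?_⟩, ?_, ?_⟩
    · by_cases h : i = j
      · subst h
        rw [Function.update_self]
        norm_num
      · simp [Function.update_of_ne h]
    · rw [Function.update_of_ne (fun h : i = j => hi (h ▸ Finset.mem_insert_self _ _))]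
      rfl
    · refine (Finset.card_le_card (fracCoords_update_subset _ _ _)).trans ?_
      refine (Finset.card_insert_le _ _).trans ?_
      simp [fracCoords]
    · rw [Function.update_self]
      norm_num
    · rw [Function.update_self]
      norm_num
  -- Induction on the number of nonzero coordinates other than `j`.
  suffices h : ∀ (m : ℕ) (p : ι → ℝ), p ∈ middleBand J j →
      (Finset.univ.filter fun i => i ≠ j ∧ p i ≠ 0).card = m →
      JoinedIn (middleBand J j) p (Function.update 0 j (1 / 2)) from
    ⟨_, hb, fun {p} hp => (h _ p hp rfl).symm⟩
  intro m
  induction m with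
  | zero =>
    intro p hp hm
    have hp0 : ∀ i, i ≠ j → p i = 0 := by
      intro i hi
      by_contra h
      have : i ∈ (Finset.univ.filter fun i => i ≠ j ∧ p i ≠ 0) := by simp [hi, h]
      rw [Finset.card_eq_zero.1 hm] at this
      simp at this
    have hupd : Function.update (0 : ι → ℝ) j (1 / 2) = Function.update p j (1 / 2) := by
      funext i
      by_cases h : i = j
      · subst h
        simp
      · simp [Function.update_of_ne h, hp0 i h]
    rw [hupd]
    refine JoinedIn.of_segment_subset ?_
    rintro _ ⟨a, b, ha, hb', hab, rfl⟩
    rw [combo_update p j _ hab]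
    have h1 := hp.2.1
    have h2 := hp.2.2
    have e1 : 1 / 3 < a * p j + b * (1 / 2) := by nlinarith
    have e2 : a * p j + b * (1 / 2) < 2 / 3 := by nlinarith
    refine ⟨update_mem_cubeSkeleton hp.1 (fun i hi _ => hi) ⟨by linarith, by linarith⟩
      (Or.inl (Finset.mem_insert_self _ _)) ?_, ?_, ?_⟩
    · refine (Finset.card_le_card (fracCoords_update_subset_of_imp ?_)).trans hp.1.2.2
      rintro (h | h) <;> linarith
    · rwa [Function.update_self]
    · rwa [Function.update_self]
  | succ m ih =>
    intro p hp hm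
    -- If some other coordinate is fractional, it must be moved first, which adds no fractional
    -- coordinate. Otherwise at most `j` is fractional, and any nonzero coordinate may move without
    -- exceeding two.
    have hi : ∃ i, i ≠ j ∧ p i ≠ 0 ∧ ∀ t, (fracCoords (Function.update p i t)).card ≤ 2 := by
      by_cases hf : ∃ i, i ≠ j ∧ i ∈ fracCoords p
      · obtain ⟨i, hij, hi⟩ := hf
        refine ⟨i, hij, (mem_fracCoords.1 hi).1, fun t => ?_⟩
        refine (Finset.card_le_card (fracCoords_update_subset _ _ _)).trans ?_
        rw [Finset.insert_eq_of_mem hi]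
        exact hp.1.2.2
      · have hne : (Finset.univ.filter fun i => i ≠ j ∧ p i ≠ 0).Nonempty := by
          rw [← Finset.card_pos, hm]
          exact Nat.succ_pos m
        obtain ⟨i, hi⟩ := hne
        simp only [Finset.mem_filter, Finset.mem_univ, true_and] at hi
        refine ⟨i, hi.1, hi.2, fun t => ?_⟩
        have hsub : fracCoords (Function.update p i t) ⊆ {i, j} := by
          refine (fracCoords_update_subset _ _ _).trans (Finset.insert_subset_insert _ ?_)
          intro k hk
          by_contra hkj
          exact hf ⟨k, by simpa using hkj, hk⟩
        exact (Finset.card_le_card hsub).trans Finset.card_le_two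
    obtain ⟨i, hij, hi0, hcard⟩ := hi
    have hiJ : i ∈ insert j J := by
      by_contra h
      exact hi0 (hp.1.2.1 i h)
    have hmem : ∀ t ∈ Set.Icc (0 : ℝ) 1, Function.update p i t ∈ middleBand J j := by
      intro t ht
      refine ⟨update_mem_cubeSkeleton hp.1 (fun i hi _ => hi) ht (Or.inl hiJ) (hcard t), ?_, ?_⟩
      · rw [Function.update_of_ne hij.symm]
        exact hp.2.1
      · rw [Function.update_of_ne hij.symm]
        exact hp.2.2
    refine JoinedIn.trans (y := Function.update p i 0) ?_
      (ih _ (hmem 0 ⟨le_rfl, zero_le_one⟩) ?_)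
    · refine JoinedIn.of_segment_subset ?_
      rintro _ ⟨a, b, ha, hb', hab, rfl⟩
      rw [combo_update p i _ hab]
      have hpi := hp.1.1 i
      refine hmem _ ⟨?_, ?_⟩
      · rw [mul_zero, add_zero]
        exact mul_nonneg ha hpi.1
      · rw [mul_zero, add_zero]
        exact mul_le_one₀ (by linarith) hpi.1 hpi.2
    · have he : (Finset.univ.filter fun k => k ≠ j ∧ Function.update p i 0 k ≠ 0) =
          (Finset.univ.filter fun k => k ≠ j ∧ p k ≠ 0).erase i := by
        ext k
        by_cases h : k = i
        · subst h
          simp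
        · simp [Function.update_of_ne h, h]
      rw [he, Finset.card_erase_of_mem (by simp [hij, hi0]), hm]
      rfl

/-- The part of the `2`-skeleton on which the coordinate `j` is close to `a`. -/
def endBand (J : Finset ι) (j : ι) (a : ℝ) : Set (cubeSkeleton 2 (insert j J)) :=
  {x | a - 2 / 3 < x.1 j ∧ x.1 j < a + 2 / 3}

theorem isOpen_endBand (J : Finset ι) (j : ι) (a : ℝ) : IsOpen (endBand J j a) := by
  have h : Continuous fun x : cubeSkeleton 2 (insert j J) => x.1 j :=
    (continuous_apply j).comp continuous_subtype_val
  exact (isOpen_lt continuous_const h).inter (isOpen_lt h continuous_const)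

/-- Linear contraction of the coordinate `j` to `a`, the identity at `s = 1`. Because 2/3 < 1, the
band misses the opposite end, so an integral coordinate `j` already equals `a` and stays there; no
new fractional coordinate appears. -/
theorem contract_mem {J : Finset ι} {j : ι} {a : ℝ} (ha : a = 0 ∨ a = 1) (s : unitInterval)
    (x : endBand J j a) :
    ∃ h : Function.update x.1.1 j (a + s * (x.1.1 j - a)) ∈ cubeSkeleton 2 (insert j J),
      (⟨_, h⟩ : cubeSkeleton 2 (insert j J)) ∈ endBand J j a := by
  obtain ⟨⟨p, hp⟩, hx, hx'⟩ := x
  change a - 2 / 3 < p j at hx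
  change p j < a + 2 / 3 at hx'
  change ∃ h : Function.update p j (a + s * (p j - a)) ∈ _, _
  obtain ⟨h0, h1⟩ := hp.1 j
  have hs0 := s.2.1
  have hs1 := s.2.2
  refine ⟨update_mem_cubeSkeleton hp (fun i hi _ => hi) ?_
      (Or.inl (Finset.mem_insert_self _ _)) ?_, ?_⟩
  · rcases ha with rfl | rfl
    · constructor <;> nlinarith
    · constructor <;> nlinarith
  · refine (Finset.card_le_card (fracCoords_update_subset_of_imp ?_)).trans hp.2.2
    intro h
    have hpa : p j = a := by
      rcases ha with rfl | rfl <;> rcases h with h | h <;> linarith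
    simpa [hpa] using ha
  · change a - 2 / 3 < Function.update p j (a + s * (p j - a)) j ∧
      Function.update p j (a + s * (p j - a)) j < a + 2 / 3
    rw [Function.update_self]
    constructor <;> nlinarith

/-- Moving the coordinate `j` to `a` deforms the part near `a` onto a smaller skeleton. -/
def endBandEquiv (J : Finset ι) (j : ι) (hj : j ∉ J) {a : ℝ} (ha : a = 0 ∨ a = 1) :
    ContinuousMap.HomotopyEquiv (endBand J j a) (cubeSkeleton 2 J) where
  -- The coordinate is reset to 0 even when `a = 1`, since points of the smaller skeleton vanish
  -- outside `J`.
  toFun := ⟨fun x => ⟨Function.update x.1.1 j 0,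
      update_mem_cubeSkeleton x.1.2 (fun i hi hij => by simp [hi, hij]) (by simp) (Or.inr rfl)
        ((Finset.card_le_card (fracCoords_update_subset_of_imp fun _ => Or.inl rfl)).trans
          x.1.2.2.2)⟩, by fun_prop⟩
  invFun := ⟨fun p => ⟨⟨Function.update p.1 j a,
      update_mem_cubeSkeleton p.2 (fun i hi _ h => hi (Finset.mem_insert_of_mem h))
        (by rcases ha with rfl | rfl <;> simp) (Or.inl (Finset.mem_insert_self _ _))
        ((Finset.card_le_card (fracCoords_update_subset_of_imp fun _ => ha)).trans p.2.2.2)⟩,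
      by simp [endBand]⟩, by fun_prop⟩
  left_inv := by
    refine ⟨⟨⟨fun q => ⟨⟨_, (contract_mem ha q.1 q.2).1⟩, (contract_mem ha q.1 q.2).2⟩, ?_⟩, ?_, ?_⟩⟩
    · refine Continuous.subtype_mk (Continuous.subtype_mk ?_ _) _
      have h : Continuous fun q : unitInterval × endBand J j a => q.2.1.1 := by fun_prop
      exact h.update j (continuous_const.add ((continuous_subtype_val.comp continuous_fst).mul
        (((continuous_apply j).comp h).sub continuous_const)))
    · intro x
      apply Subtype.ext
      apply Subtype.ext
      simp
    · intro x
      apply Subtype.ext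
      apply Subtype.ext
      simp
  right_inv := by
    convert ContinuousMap.Homotopic.refl _
    ext p : 2
    have hp : p.1 j = 0 := p.2.2.1 j hj
    simp [← hp]

/-- The `2`-skeleton of a cube is simply connected. -/
theorem simplyConnectedSpace_cubeSkeleton (J : Finset ι) :
    SimplyConnectedSpace (cubeSkeleton 2 J) := by
  induction J using Finset.induction_on with
  | empty =>
    have h : cubeSkeleton 2 (∅ : Finset ι) = {0} := by
      ext p
      constructor
      · intro hp
        funext i
        exact hp.2.1 i (Finset.notMem_empty i)
      · rintro rfl
        exact ⟨by simp, by simp, by simp [fracCoords]⟩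
    rw [h]
    have := (convex_singleton (𝕜 := ℝ) (0 : ι → ℝ)).contractibleSpace ⟨0, rfl⟩
    infer_instance
  | insert j J hj ih =>
    have h0 : SimplyConnectedSpace (endBand J j 0) :=
      (endBandEquiv J j hj (Or.inl rfl)).simplyConnectedSpace
    have h1 : SimplyConnectedSpace (endBand J j 1) :=
      (endBandEquiv J j hj (Or.inr rfl)).simplyConnectedSpace
    -- The ends are the parts with coordinate below 2/3 and above 1/3; they cover, and they overlap
    -- exactly in the middle band.
    refine SimplyConnectedSpace.of_union (isOpen_endBand J j 0) (isOpen_endBand J j 1) ?_ ?_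
    · refine Set.eq_univ_of_forall fun x => ?_
      have hx := x.2.1 j
      rcases lt_or_ge (x.1 j) (1 / 2) with h | h
      · exact Or.inl ⟨by linarith [hx.1], by linarith⟩
      · exact Or.inr ⟨by linarith, by linarith [hx.2]⟩
    · convert (isPathConnected_middleBand J j).preimage_coe fun p hp => hp.1 using 1
      ext x
      have hx := x.2.1 j
      constructor
      · rintro ⟨h, h'⟩
        exact ⟨x.2, by linarith [h'.1], by linarith [h.2]⟩
      · rintro ⟨-, h, h'⟩
        exact ⟨⟨by linarith [hx.1], by linarith⟩, by linarith, by linarith [hx.2]⟩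

end Skeleton

/-! ### Neighbours, edges and squares of a chromotopology in terms of colours. -/

section Combinatorics

variable {n : ℕ} {V W : Type*} [Fintype V] [DecidableEq V] [Fintype W] [DecidableEq W]

namespace Chromotopology

variable (A : Chromotopology n V)

theorem ColorAdj.symm {A : Chromotopology n V} {i : Fin n} {u v : V} (h : A.ColorAdj i u v) :
    A.ColorAdj i v u := by
  obtain ⟨h, hc⟩ := h
  refine ⟨h.symm, ?_⟩
  rw [← hc]
  congr 1
  exact Subtype.ext Sym2.eq_swap

theorem existsUnique_colorAdj (i : Fin n) (v : V) : ∃! u, A.ColorAdj i v u := by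
  obtain ⟨e, ⟨hv, he⟩, huniq⟩ := A.existsUnique_edge v i
  obtain ⟨a, b, h, rfl⟩ := exists_edgeOf e
  have key : ∀ u w, A.ColorAdj i v u → A.ColorAdj i v w → u = w := by
    rintro u w ⟨h1, hc1⟩ ⟨h2, hc2⟩
    have e1 := huniq (edgeOf h1) ⟨Sym2.mem_mk_left _ _, hc1⟩
    have e2 := huniq (edgeOf h2) ⟨Sym2.mem_mk_left _ _, hc2⟩
    have e3 : s(v, u) = s(v, w) := congrArg Subtype.val (e1.trans e2.symm)
    exact Sym2.congr_right.1 e3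
  have hex : ∃ u, A.ColorAdj i v u := by
    rcases Sym2.mem_iff.1 hv with rfl | rfl
    · exact ⟨b, h, he⟩
    · exact ⟨a, ColorAdj.symm ⟨h, he⟩⟩
  obtain ⟨u, hu⟩ := hex
  exact ⟨u, hu, fun w hw => key w u hw hu⟩

/-- The neighbour of `v` along the edge of colour `i`. -/
def nbr (i : Fin n) (v : V) : V := (A.existsUnique_colorAdj i v).choose

theorem colorAdj_iff {i : Fin n} {u v : V} : A.ColorAdj i u v ↔ v = A.nbr i u := by
  constructor
  · exact (A.existsUnique_colorAdj i u).choose_spec.2 v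
  · rintro rfl
    exact (A.existsUnique_colorAdj i u).choose_spec.1

theorem colorAdj_nbr (i : Fin n) (v : V) : A.ColorAdj i v (A.nbr i v) := A.colorAdj_iff.2 rfl

theorem nbr_nbr (i : Fin n) (v : V) : A.nbr i (A.nbr i v) = v :=
  (A.colorAdj_iff.1 (A.colorAdj_nbr i v).symm).symm

theorem adj_nbr (i : Fin n) (v : V) : A.graph.Adj v (A.nbr i v) := (A.colorAdj_nbr i v).1

theorem eq_nbr_color {u v : V} (h : A.graph.Adj u v) : v = A.nbr (A.color (edgeOf h)) u :=
  A.colorAdj_iff.1 ⟨h, rfl⟩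

theorem nbr_ne (i : Fin n) (v : V) : A.nbr i v ≠ v := (A.adj_nbr i v).ne.symm

/-- The edge of colour `i` at the vertex `v`. -/
def edge (i : Fin n) (v : V) : A.Edge := edgeOf (A.adj_nbr i v)

theorem color_edge (i : Fin n) (v : V) : A.color (A.edge i v) = i := (A.colorAdj_nbr i v).2

theorem mem_edge {i : Fin n} {u v : V} : u ∈ (A.edge i v).1 ↔ u = v ∨ u = A.nbr i v :=
  Sym2.mem_iff

theorem eq_edge {v : V} {e : A.Edge} (h : v ∈ e.1) : e = A.edge (A.color e) v :=
  (A.existsUnique_edge v (A.color e)).unique ⟨h, rfl⟩ ⟨A.mem_edge.2 (Or.inl rfl), A.color_edge _ _⟩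

theorem exists_eq_edge (e : A.Edge) : ∃ i v, e = A.edge i v := by
  obtain ⟨u, v, h, rfl⟩ := exists_edgeOf e
  exact ⟨_, u, A.eq_edge (Sym2.mem_mk_left _ _)⟩

theorem edge_nbr (i : Fin n) (v : V) : A.edge i (A.nbr i v) = A.edge i v := by
  have h := A.eq_edge (e := A.edge i v) (A.mem_edge.2 (Or.inr rfl))
  rw [A.color_edge] at h
  exact h.symm

theorem edge_eq_iff {i j : Fin n} {u v : V} :
    A.edge i u = A.edge j v ↔ i = j ∧ (u = v ∨ u = A.nbr j v) := by
  constructor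
  · intro h
    refine ⟨by rw [← A.color_edge i u, h, A.color_edge], ?_⟩
    rw [← A.mem_edge, ← h]
    exact A.mem_edge.2 (Or.inl rfl)
  · rintro ⟨rfl, rfl | rfl⟩
    · rfl
    · exact A.edge_nbr i v

/-- The graph is simple: two colours leading to the same neighbour would belong to the same edge. -/
theorem nbr_eq_nbr_iff {i j : Fin n} {v : V} : A.nbr i v = A.nbr j v ↔ i = j := by
  refine ⟨fun h => ?_, fun h => h ▸ rfl⟩
  have h' : A.edge i v = A.edge j v := by
    rw [← A.edge_nbr j v, ← h]
    have := A.eq_edge (e := A.edge j v) (A.mem_edge.2 (Or.inr h))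
    rw [A.color_edge] at this
    rw [← this]
    exact Subtype.ext (congrArg (fun w => s(v, w)) h)
  exact (A.edge_eq_iff.1 h').1

/-- Following one colour twice leads back, so consecutive edges of a 4-cycle differ in colour, and
with only two colours available they alternate. This serves both the cycles supplied by `fourCycles`
and the faces. -/
theorem fourCycle_colors {a b c d : V} (hab : A.graph.Adj a b) (hbc : A.graph.Adj b c)
    (hcd : A.graph.Adj c d) (hda : A.graph.Adj d a) (hac : a ≠ c) (hbd : b ≠ d) {k l : Fin n}
    (hkl : ∀ e ∈ cycleEdges hab hbc hcd hda, A.color e = k ∨ A.color e = l) :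
    ∃ i j, i ≠ j ∧ (i = k ∧ j = l ∨ i = l ∧ j = k) ∧
      b = A.nbr i a ∧ c = A.nbr j b ∧ d = A.nbr i c ∧ a = A.nbr j d := by
  simp only [cycleEdges, Finset.mem_insert, Finset.mem_singleton, forall_eq_or_imp, forall_eq]
    at hkl
  obtain ⟨h1, h2, h3, h4⟩ := hkl
  have e1 := A.eq_nbr_color hab
  have e2 := A.eq_nbr_color hbc
  have e3 := A.eq_nbr_color hcd
  have e4 := A.eq_nbr_color hda
  generalize A.color (edgeOf hab) = c1 at *
  generalize A.color (edgeOf hbc) = c2 at *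
  generalize A.color (edgeOf hcd) = c3 at *
  generalize A.color (edgeOf hda) = c4 at *
  have n12 : c1 ≠ c2 := by
    rintro rfl
    rw [e1, A.nbr_nbr] at e2
    exact hac e2.symm
  have n23 : c2 ≠ c3 := by
    rintro rfl
    rw [e2, A.nbr_nbr] at e3
    exact hbd e3.symm
  have n34 : c3 ≠ c4 := by
    rintro rfl
    rw [e3, A.nbr_nbr] at e4
    exact hac e4
  have h13 : c3 = c1 := by
    rcases h1 with rfl | rfl <;> rcases h2 with rfl | rfl <;> rcases h3 with rfl | rfl <;>
      first | rfl | exact absurd rfl n12 | exact absurd rfl n23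
  have h24 : c4 = c2 := by
    rcases h4 with rfl | rfl <;> rcases h2 with rfl | rfl <;> rcases h3 with rfl | rfl <;>
      first | rfl | exact absurd rfl n34 | exact absurd rfl n23
  subst h13 h24
  refine ⟨c3, c4, n12, ?_, e1, e2, e3, e4⟩
  rcases h1 with rfl | rfl <;> rcases h2 with rfl | rfl <;>
    first | exact absurd rfl n12 | simp

theorem exists_vertex_of_mem_cycleEdges {a b c d u : V} {hab : A.graph.Adj a b}
    {hbc : A.graph.Adj b c} {hcd : A.graph.Adj c d} {hda : A.graph.Adj d a} {e : A.Edge}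
    (he : e ∈ cycleEdges hab hbc hcd hda) (hu : u ∈ e.1) : u = a ∨ u = b ∨ u = c ∨ u = d := by
  simp only [cycleEdges, Finset.mem_insert, Finset.mem_singleton] at he
  rcases he with rfl | rfl | rfl | rfl <;> rcases Sym2.mem_iff.1 hu with rfl | rfl <;> simp

/-- For distinct colours, `v` lies on a 4-cycle alternating between them, and both ways around it
lead to the opposite corner. -/
theorem nbr_comm (i j : Fin n) (v : V) : A.nbr i (A.nbr j v) = A.nbr j (A.nbr i v) := by
  by_cases hij : i = j
  · rw [hij]
  obtain ⟨S, hS, -, hmem⟩ := A.fourCycles i j hij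
  obtain ⟨C, hC, he⟩ := (hmem (A.edge i v)).1 (Or.inl (A.color_edge i v))
  have hcol : ∀ e ∈ C, A.color e = i ∨ A.color e = j := fun e he => (hmem e).2 ⟨C, hC, he⟩
  obtain ⟨a, b, c, d, hab, hbc, hcd, hda, hac, hbd, rfl⟩ := hS C hC
  have hv := A.exists_vertex_of_mem_cycleEdges he (A.mem_edge.2 (Or.inl rfl))
  obtain ⟨k, l, -, hkl, h1, h2, h3, h4⟩ := A.fourCycle_colors hab hbc hcd hda hac hbd hcol
  have hd : d = A.nbr l a := by rw [h4, A.nbr_nbr]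
  have hc : c = A.nbr k (A.nbr l a) := by rw [← hd, h3, A.nbr_nbr]
  have comm : A.nbr l (A.nbr k a) = A.nbr k (A.nbr l a) := by rw [← h1, ← h2, hc]
  suffices h : A.nbr l (A.nbr k v) = A.nbr k (A.nbr l v) by
    rcases hkl with ⟨rfl, rfl⟩ | ⟨rfl, rfl⟩
    · exact h.symm
    · exact h
  -- The relation is known at the corner `a`; `v` may be any of the four corners, from which it is
  -- transported by the involutions.
  rcases hv with rfl | rfl | rfl | rfl
  · exact comm
  · rw [h1, A.nbr_nbr, comm, A.nbr_nbr]
  · rw [hc, A.nbr_nbr, ← comm, A.nbr_nbr, A.nbr_nbr, A.nbr_nbr]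
  · rw [hd, A.nbr_nbr, ← comm, A.nbr_nbr]

/-- The edges of the `4`-cycle of colours `i` and `j` through `v`. -/
def square (i j : Fin n) (v : V) : Finset A.Edge :=
  {A.edge i v, A.edge j (A.nbr i v), A.edge i (A.nbr j v), A.edge j v}

theorem mem_square {i j : Fin n} {v : V} {e : A.Edge} :
    e ∈ A.square i j v ↔ e = A.edge i v ∨ e = A.edge j (A.nbr i v) ∨
      e = A.edge i (A.nbr j v) ∨ e = A.edge j v := by
  simp [square]

theorem square_comm (i j : Fin n) (v : V) : A.square i j v = A.square j i v := by
  ext e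
  rw [mem_square, mem_square]
  tauto

theorem square_nbr_left (i j : Fin n) (v : V) : A.square i j (A.nbr i v) = A.square i j v := by
  ext e
  rw [mem_square, mem_square, A.nbr_nbr, A.edge_nbr, A.nbr_comm j i, A.edge_nbr]
  tauto

theorem square_nbr_right (i j : Fin n) (v : V) : A.square i j (A.nbr j v) = A.square i j v := by
  rw [A.square_comm, A.square_nbr_left, A.square_comm]

theorem mem_square_vertex {i j : Fin n} {u v : V} :
    (∃ e ∈ A.square i j v, u ∈ e.1) ↔
      u = v ∨ u = A.nbr i v ∨ u = A.nbr j v ∨ u = A.nbr i (A.nbr j v) := by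
  constructor
  · rintro ⟨e, he, hu⟩
    rw [mem_square] at he
    rcases he with rfl | rfl | rfl | rfl <;> rcases A.mem_edge.1 hu with rfl | rfl <;>
      simp [A.nbr_comm j i]
  · rintro (rfl | rfl | rfl | rfl)
    · exact ⟨_, A.mem_square.2 (Or.inl rfl), A.mem_edge.2 (Or.inl rfl)⟩
    · exact ⟨_, A.mem_square.2 (Or.inl rfl), A.mem_edge.2 (Or.inr rfl)⟩
    · exact ⟨_, A.mem_square.2 (Or.inr (Or.inr (Or.inl rfl))), A.mem_edge.2 (Or.inl rfl)⟩
    · exact ⟨_, A.mem_square.2 (Or.inr (Or.inr (Or.inl rfl))), A.mem_edge.2 (Or.inr rfl)⟩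

theorem square_eq_of_vertex {i j : Fin n} {u v : V}
    (h : u = v ∨ u = A.nbr i v ∨ u = A.nbr j v ∨ u = A.nbr i (A.nbr j v)) :
    A.square i j u = A.square i j v := by
  rcases h with rfl | rfl | rfl | rfl
  · rfl
  · exact A.square_nbr_left i j v
  · exact A.square_nbr_right i j v
  · rw [A.square_nbr_left, A.square_nbr_right]

theorem image_color_square (i j : Fin n) (v : V) : (A.square i j v).image A.color = {i, j} := by
  ext k
  simp only [Finset.mem_image, mem_square, Finset.mem_insert, Finset.mem_singleton]
  constructor
  · rintro ⟨e, rfl | rfl | rfl | rfl, rfl⟩ <;> simp [A.color_edge]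
  · rintro (rfl | rfl)
    · exact ⟨_, Or.inl rfl, A.color_edge _ _⟩
    · exact ⟨_, Or.inr (Or.inl rfl), A.color_edge _ _⟩

/-- A square determines its colours as an image and its corners as the endpoints of its edges;
conversely its colours and any one corner determine it. -/
theorem square_eq_iff {i j k l : Fin n} {u v : V} :
    A.square i j u = A.square k l v ↔ (i = k ∧ j = l ∨ i = l ∧ j = k) ∧
      (u = v ∨ u = A.nbr k v ∨ u = A.nbr l v ∨ u = A.nbr k (A.nbr l v)) := by
  constructor
  · intro h
    constructor
    · have h' := congrArg (Finset.image A.color) h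
      rw [image_color_square, image_color_square, ← Finset.coe_inj, Finset.coe_pair,
        Finset.coe_pair, Set.pair_eq_pair_iff] at h'
      exact h'
    · rw [← A.mem_square_vertex, ← h, A.mem_square_vertex]
      exact Or.inl rfl
  · rintro ⟨⟨rfl, rfl⟩ | ⟨rfl, rfl⟩, h⟩
    · exact A.square_eq_of_vertex h
    · rw [A.square_comm]
      exact A.square_eq_of_vertex h

theorem nbr_nbr_ne {i j : Fin n} (h : i ≠ j) (v : V) : A.nbr i (A.nbr j v) ≠ v := fun h' => by
  refine h ((A.nbr_eq_nbr_iff (v := v)).1 ?_)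
  rw [← h', A.nbr_nbr, h']

theorem adj_opposite (i j : Fin n) (v : V) :
    A.graph.Adj (A.nbr j (A.nbr i v)) (A.nbr j v) := by
  rw [A.nbr_comm j i]
  exact (A.adj_nbr i _).symm

theorem square_eq_cycleEdges (i j : Fin n) (v : V) :
    A.square i j v = cycleEdges (A.adj_nbr i v) (A.adj_nbr j (A.nbr i v)) (A.adj_opposite i j v)
      (A.adj_nbr j v).symm := by
  ext e
  simp only [mem_square, cycleEdges, Finset.mem_insert, Finset.mem_singleton]
  have h1 : edgeOf (A.adj_opposite i j v) = A.edge i (A.nbr j v) :=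
    Subtype.ext ((congrArg (fun w => s(w, A.nbr j v)) (A.nbr_comm j i v)).trans Sym2.eq_swap)
  have h2 : edgeOf (A.adj_nbr j v).symm = A.edge j v := Subtype.ext Sym2.eq_swap
  rw [h1, h2]
  rfl

theorem isTwoColoredFourCycle_square {i j : Fin n} (hij : i ≠ j) (v : V) :
    A.IsTwoColoredFourCycle (A.square i j v) := by
  refine ⟨⟨_, _, _, _, _, _, _, _, (A.nbr_nbr_ne hij.symm v).symm, fun h => hij ?_,
    A.square_eq_cycleEdges i j v⟩, ?_⟩
  · exact A.nbr_eq_nbr_iff.1 h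
  · rw [image_color_square, Finset.card_pair hij]

/-- The face of colours `i` and `j` at the vertex `v`. -/
def face {i j : Fin n} (hij : i ≠ j) (v : V) : A.Face :=
  ⟨A.square i j v, A.isTwoColoredFourCycle_square hij v⟩

/-- The corners of a labelled face are obtained from the first one by following two colours. -/
theorem face_corners (C : A.Face) {a b c d : V} {hab : A.graph.Adj a b} {hbc : A.graph.Adj b c}
    {hcd : A.graph.Adj c d} {hda : A.graph.Adj d a} (hac : a ≠ c) (hbd : b ≠ d)
    (hC : C.1 = cycleEdges hab hbc hcd hda) :
    ∃ i j, i ≠ j ∧ b = A.nbr i a ∧ c = A.nbr j (A.nbr i a) ∧ d = A.nbr j a ∧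
      C.1 = A.square i j a := by
  obtain ⟨k, l, -, hkl⟩ := Finset.card_eq_two.1 C.2.2
  obtain ⟨i, j, hij, -, rfl, rfl, -, h4⟩ := A.fourCycle_colors hab hbc hcd hda hac hbd
    (k := k) (l := l) fun e he => by
      rw [← hC] at he
      simpa [hkl] using Finset.mem_image_of_mem A.color he
  have hd : d = A.nbr j a := by rw [h4, A.nbr_nbr]
  subst hd
  exact ⟨i, j, hij, rfl, rfl, rfl, hC.trans (A.square_eq_cycleEdges i j a).symm⟩

theorem exists_eq_face (C : A.Face) : ∃ (i j : Fin n) (hij : i ≠ j) (v : V), C = A.face hij v := by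
  obtain ⟨a, b, c, d, hab, hbc, hcd, hda, hac, hbd, hC⟩ := C.2.1
  obtain ⟨i, j, hij, -, -, -, h⟩ := A.face_corners C hac hbd hC
  exact ⟨i, j, hij, a, Subtype.ext h⟩

theorem card_square {i j : Fin n} (hij : i ≠ j) (v : V) : (A.square i j v).card = 4 := by
  have h : ∀ k : Fin n, ∀ u w : V, u ≠ w → u ≠ A.nbr k w → A.edge k u ≠ A.edge k w := by
    intro k u w h1 h2 h3
    rcases (A.edge_eq_iff.1 h3).2 with h | h
    · exact h1 h
    · exact h2 h
  have hc : ∀ u w : V, A.edge i u ≠ A.edge j w := fun u w h => hij (A.edge_eq_iff.1 h).1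
  have h1 := h i v (A.nbr j v) (A.nbr_ne j v).symm (A.nbr_nbr_ne hij v).symm
  have h2 := h j (A.nbr i v) v (A.nbr_ne i v) fun h => hij (A.nbr_eq_nbr_iff.1 h)
  rw [square, Finset.card_insert_of_notMem, Finset.card_insert_of_notMem, Finset.card_pair (hc _ _)]
  · simp [(hc _ _).symm, h2]
  · simp [hc, h1]

end Chromotopology

namespace ColorHom

variable {A : Chromotopology n V} {B : Chromotopology n W} (f : ColorHom A B)

theorem toFun_nbr (i : Fin n) (v : V) : f.toFun (A.nbr i v) = B.nbr i (f.toFun v) :=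
  B.colorAdj_iff.1 (f.colorAdj i _ _ (A.colorAdj_nbr i v))

theorem edgeMap_edge (i : Fin n) (v : V) : f.edgeMap (A.edge i v) = B.edge i (f.toFun v) := by
  have h : f.toFun v ∈ (f.edgeMap (A.edge i v)).1 :=
    Sym2.mem_map.2 ⟨v, A.mem_edge.2 (Or.inl rfl), rfl⟩
  rw [B.eq_edge h, f.color_edgeMap, A.color_edge]

theorem image_square (i j : Fin n) (v : V) :
    (A.square i j v).image f.edgeMap = B.square i j (f.toFun v) := by
  simp only [Chromotopology.square, Finset.image_insert, Finset.image_singleton, edgeMap_edge,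
    toFun_nbr]

theorem faceMap_face {i j : Fin n} (hij : i ≠ j) (v : V) :
    f.faceMap (A.face hij v) = B.face hij (f.toFun v) :=
  Subtype.ext (f.image_square i j v)

/-- The image of a square is again a square, with four edges, so no two edges are identified. -/
theorem edgeMap_injOn (C : A.Face) : Set.InjOn f.edgeMap C.1 := by
  obtain ⟨i, j, hij, v, rfl⟩ := A.exists_eq_face C
  rw [← Finset.card_image_iff]
  change ((A.square i j v).image f.edgeMap).card = (A.square i j v).card
  rw [image_square, B.card_square hij, A.card_square hij]

end ColorHom

theorem cube_nbr (i : Fin n) (v : Bits n) : (cube n).nbr i v = v + Pi.single i 1 :=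
  (cube_colorAdj_iff.1 ((cube n).colorAdj_nbr i v))

end Combinatorics

/-! ### The code of a chromotopology and its action on cells and chains. -/

section Codes

variable {n : ℕ} {V : Type*} [Fintype V] [DecidableEq V] {A : Chromotopology n V}

/-! ### Colour-preserving maps from the cube -/

theorem Bits.induction {P : Bits n → Prop} (zero : P 0)
    (add : ∀ v i, P v → P (v + Pi.single i 1)) (v : Bits n) : P v := by
  have h := (SimpleGraph.reachable_iff_reflTransGen _ _).1 ((cube_connected (n := n)) 0 v)
  induction h with
  | refl => exact zero
  | tail _ hadj ih =>
    obtain ⟨i, rfl⟩ := cube_adj_iff.1 hadj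
    exact add _ i ih

namespace ColorHom

theorem toFun_add_single (f : ColorHom (cube n) A) (v : Bits n) (i : Fin n) :
    f.toFun (v + Pi.single i 1) = A.nbr i (f.toFun v) := by
  rw [← cube_nbr, f.toFun_nbr]

/-- Each colour leads to a unique neighbour, so two colour-preserving maps that meet at one vertex
remain together along every walk. This rigidity underlies the code and its uniqueness. -/
theorem toFun_add_eq {f g : ColorHom (cube n) A} {s t : Bits n} (h : f.toFun s = g.toFun t)
    (v : Bits n) : f.toFun (s + v) = g.toFun (t + v) := by
  induction v using Bits.induction with
  | zero => simpa using h
  | add v i ih => rw [← add_assoc, ← add_assoc, toFun_add_single, toFun_add_single, ih]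

theorem toFun_surjective (f : ColorHom (cube n) A) : Function.Surjective f.toFun := by
  intro u
  have h := (SimpleGraph.reachable_iff_reflTransGen _ _).1 (A.connected (f.toFun 0) u)
  induction h with
  | refl => exact ⟨0, rfl⟩
  | tail _ hadj ih =>
    obtain ⟨v, rfl⟩ := ih
    exact ⟨_, (f.toFun_add_single v _).trans (A.eq_nbr_color hadj).symm⟩

/-- The commuting neighbour involutions define an action of the bitstrings on the vertices; the map
is an orbit map of this action. -/
theorem exists_colorHom (A : Chromotopology n V) : Nonempty (ColorHom (cube n) A) := by
  obtain ⟨v₀⟩ := A.connected.nonempty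
  let σ (i : Fin n) : Equiv.Perm V := ⟨A.nbr i, A.nbr i, A.nbr_nbr i, A.nbr_nbr i⟩
  have hσ : ∀ i, σ i * σ i = 1 := fun i => Equiv.ext (A.nbr_nbr i)
  have hcomm : ∀ i j, Commute (σ i) (σ j) := fun i j => Equiv.ext (A.nbr_comm i j)
  let ψ (i : Fin n) : Multiplicative (ZMod 2) →* Equiv.Perm V :=
    { toFun := fun y => if y.toAdd = 0 then 1 else σ i
      map_one' := rfl
      map_mul' := fun x y => by
        have key : ∀ a b : ZMod 2, (if a + b = 0 then 1 else σ i) =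
            (if a = 0 then 1 else σ i) * if b = 0 then 1 else σ i := by
          intro a b
          have h01 : ∀ c : ZMod 2, c = 0 ∨ c = 1 := by decide
          rcases h01 a with rfl | rfl <;> rcases h01 b with rfl | rfl
          · simp
          · simp
          · simp
          · simp [hσ, show (1 + 1 : ZMod 2) = 0 from by decide]
        exact key x.toAdd y.toAdd }
  have hψ : ∀ i j x y, Commute (ψ i x) (ψ j y) := by
    intro i j x y
    change Commute (if x.toAdd = 0 then 1 else σ i) (if y.toAdd = 0 then 1 else σ j)
    split_ifs
    · exact Commute.one_left _
    · exact Commute.one_left _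
    · exact Commute.one_right _
    · exact hcomm i j
  -- The permutation group is not commutative, but the images of the factors commute, so the
  -- homomorphisms `ψ i` combine into one on the product.
  let Ψ := MonoidHom.noncommPiCoprod ψ fun i j _ => hψ i j
  refine ⟨⟨fun v => Ψ (fun i => Multiplicative.ofAdd (v i)) v₀, ?_⟩⟩
  intro i u v h
  rw [cube_colorAdj_iff] at h
  subst h
  rw [A.colorAdj_iff]
  have hmul : (fun j => Multiplicative.ofAdd ((u + Pi.single i 1 : Bits n) j)) =
      Pi.mulSingle i (Multiplicative.ofAdd 1) * fun j => Multiplicative.ofAdd (u j) := by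
    funext j
    by_cases hj : j = i
    · subst hj
      simp [mul_comm]
    · simp [Pi.mulSingle_eq_of_ne hj, Pi.single_eq_of_ne hj]
  have hsingle : Ψ (Pi.mulSingle i (Multiplicative.ofAdd 1)) = σ i :=
    MonoidHom.noncommPiCoprod_mulSingle ψ i _
  rw [hmul, map_mul, hsingle]
  rfl

/-- The translations of the cube under which `f` is invariant. -/
def code (f : ColorHom (cube n) A) : Submodule (ZMod 2) (Bits n) where
  carrier := {l | f.toFun l = f.toFun 0}
  zero_mem' := rfl
  add_mem' {s t} hs ht := by
    change f.toFun (s + t) = f.toFun 0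
    rw [toFun_add_eq (g := f) (t := 0) hs t, zero_add]
    exact ht
  smul_mem' c s hs := by
    have h01 : ∀ c : ZMod 2, c = 0 ∨ c = 1 := by decide
    rcases h01 c with rfl | rfl
    · rw [zero_smul]
      rfl
    · rwa [one_smul]

theorem mem_code {f : ColorHom (cube n) A} {l : Bits n} :
    l ∈ f.code ↔ f.toFun l = f.toFun 0 := Iff.rfl

/-- Translating both arguments by the same bitstring preserves equality of values, so the fibre over
the image of 0 determines all the others. -/
theorem toFun_eq_iff (f : ColorHom (cube n) A) {u v : Bits n} :
    f.toFun u = f.toFun v ↔ u - v ∈ f.code := by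
  rw [mem_code]
  constructor
  · intro h
    simpa [sub_eq_add_neg] using toFun_add_eq h (-v)
  · intro h
    simpa using toFun_add_eq h v

/-- The cube modulo the code of `f` is the target of `f`. -/
def labelling (f : ColorHom (cube n) A) : CodeLabelling A f.code where
  toEquiv := Equiv.ofBijective
    (fun x => Quotient.liftOn' x f.toFun fun u v h => by
      rw [toFun_eq_iff]
      exact (Submodule.quotientRel_def _).1 h)
    ⟨by
      intro x y
      obtain ⟨u, rfl⟩ := Submodule.mkQ_surjective _ x
      obtain ⟨v, rfl⟩ := Submodule.mkQ_surjective _ y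
      intro h
      exact (Submodule.Quotient.eq _).2 (f.toFun_eq_iff.1 h), fun u => by
      obtain ⟨v, rfl⟩ := f.toFun_surjective u
      exact ⟨f.code.mkQ v, rfl⟩⟩
  colorAdj_iff i x y := by
    constructor
    · rintro ⟨u, v, rfl, rfl, h⟩
      exact f.colorAdj i u v h
    · intro h
      obtain ⟨u, rfl⟩ := Submodule.mkQ_surjective _ x
      obtain ⟨v, rfl⟩ := Submodule.mkQ_surjective _ y
      change A.ColorAdj i (f.toFun u) (f.toFun v) at h
      -- Lift the edge starting at `u`; its other end need not be `v`, but it lies in the class of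
      -- `v`.
      rw [A.colorAdj_iff, ← toFun_add_single] at h
      exact ⟨u, u + Pi.single i 1, rfl, ((Submodule.Quotient.eq _).2 (f.toFun_eq_iff.1 h)).symm,
        cube_colorAdj_iff.2 rfl⟩

end ColorHom

/-- This reduces statements about arbitrary labellings to statements about colour-preserving maps
and their codes. -/
theorem CodeLabelling.code_proj {L : Submodule (ZMod 2) (Bits n)} (φ : CodeLabelling A L) :
    φ.proj.code = L := by
  ext l
  rw [ColorHom.mem_code]
  change φ.toEquiv (L.mkQ l) = φ.toEquiv (L.mkQ 0) ↔ l ∈ L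
  rw [φ.toEquiv.apply_eq_iff_eq, map_zero]
  exact Submodule.Quotient.mk_eq_zero L

/-- By rigidity `g` is a translate of `f`, and in a commutative group translation does not change
stabilisers. -/
theorem code_eq_code (f g : ColorHom (cube n) A) : f.code = g.code := by
  obtain ⟨s, hs⟩ := f.toFun_surjective (g.toFun 0)
  ext l
  rw [ColorHom.mem_code, ColorHom.mem_code]
  have h1 := ColorHom.toFun_add_eq hs l
  rw [zero_add] at h1
  rw [← h1, ← hs, f.toFun_eq_iff, f.toFun_eq_iff, sub_zero, add_sub_cancel_left]

theorem existsUnique_code (A : Chromotopology n V) :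
    ∃! L : Submodule (ZMod 2) (Bits n), Nonempty (CodeLabelling A L) := by
  obtain ⟨f⟩ := ColorHom.exists_colorHom A
  refine ⟨f.code, ⟨f.labelling⟩, ?_⟩
  rintro L ⟨φ⟩
  rw [← φ.code_proj]
  exact code_eq_code _ _

/-! ### The orbits and the weights of the code -/

namespace ColorHom

variable (f : ColorHom (cube n) A)

theorem isOrbitMap_toFun : IsOrbitMap f.code f.toFun := by
  refine ⟨f.toFun_surjective, fun u v => ?_⟩
  rw [eq_comm, f.toFun_eq_iff]
  constructor
  · intro h
    exact ⟨⟨v - u, h⟩, sub_add_cancel v u⟩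
  · rintro ⟨l, rfl⟩
    change (l : Bits n) + u - u ∈ _
    rw [add_sub_cancel_right]
    exact l.2

theorem toFun_vadd (l : f.code) (v : Bits n) : f.toFun ((l : Bits n) + v) = f.toFun v :=
  ((f.isOrbitMap_toFun.2 v _).2 ⟨l, rfl⟩).symm

theorem exists_vadd_of_toFun_eq {u v : Bits n} (h : f.toFun u = f.toFun v) :
    ∃ l : f.code, (l : Bits n) + u = v := (f.isOrbitMap_toFun.2 u v).1 h

end ColorHom

/-- The support of a bitstring. -/
def bitSupport (l : Bits n) : Finset (Fin n) := Finset.univ.filter fun i => l i ≠ 0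

theorem mem_bitSupport {l : Bits n} {i : Fin n} : i ∈ bitSupport l ↔ l i ≠ 0 := by
  simp [bitSupport]

theorem sum_bitSupport (l : Bits n) : ∑ i ∈ bitSupport l, Pi.single i 1 = l := by
  have h01 : ∀ a : ZMod 2, a ≠ 0 → 1 = a := by decide
  funext j
  rw [Finset.sum_apply, Finset.sum_pi_single]
  split_ifs with h
  · exact h01 _ (mem_bitSupport.1 h)
  · exact (not_not.1 (fun h' => h (mem_bitSupport.2 h'))).symm

/-- A closed walk of length 3 is impossible in a bipartite graph. -/
theorem Chromotopology.nbr_nbr_nbr_ne (A : Chromotopology n V) (i j k : Fin n) (v : V) :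
    A.nbr i (A.nbr j (A.nbr k v)) ≠ v := by
  obtain ⟨c⟩ := A.bipartite
  have h : ∀ m u, c u ≠ c (A.nbr m u) := fun m u => c.map_rel (A.adj_nbr m u)
  intro h'
  have h1 := h k v
  have h2 := h j (A.nbr k v)
  have h3 := h i (A.nbr j (A.nbr k v))
  rw [h'] at h3
  omega

/-- Every nonzero word of the code of a chromotopology has weight at least `4`. -/
theorem ColorHom.eq_zero_of_card_le (f : ColorHom (cube n) A) {l : Bits n} (hl : l ∈ f.code)
    (hcard : (bitSupport l).card ≤ 3) : l = 0 := by
  have hsum := sum_bitSupport l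
  rw [mem_code] at hl
  -- A word of the code spells a closed walk at the image of 0, with the bits in its support as
  -- colours. Lengths 1, 2 and 3 are excluded by the absence of loops, of double edges and of odd
  -- cycles.
  interval_cases h : (bitSupport l).card
  · rw [Finset.card_eq_zero.1 h, Finset.sum_empty] at hsum
    exact hsum.symm
  · obtain ⟨i, hi⟩ := Finset.card_eq_one.1 h
    rw [hi, Finset.sum_singleton, ← zero_add (Pi.single i 1)] at hsum
    rw [← hsum, f.toFun_add_single] at hl
    exact absurd hl (A.nbr_ne _ _)
  · obtain ⟨i, j, hij, hi⟩ := Finset.card_eq_two.1 h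
    rw [hi, Finset.sum_pair hij, ← zero_add (Pi.single i 1)] at hsum
    rw [← hsum, f.toFun_add_single, f.toFun_add_single] at hl
    exact absurd hl (A.nbr_nbr_ne hij.symm _)
  · obtain ⟨i, j, k, hij, hik, hjk, hi⟩ := Finset.card_eq_three.1 h
    rw [hi, Finset.sum_insert (by simp [hij, hik]), Finset.sum_pair hjk, ← add_assoc,
      ← zero_add (Pi.single i 1)] at hsum
    rw [← hsum, f.toFun_add_single, f.toFun_add_single, f.toFun_add_single] at hl
    exact absurd hl (A.nbr_nbr_nbr_ne _ _ _ _)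

theorem bitSupport_add_subset (s t : Bits n) :
    bitSupport (s + t) ⊆ bitSupport s ∪ bitSupport t := by
  intro i hi
  rw [Finset.mem_union, mem_bitSupport, mem_bitSupport]
  rw [mem_bitSupport] at hi
  by_contra h
  push Not at h
  exact hi (by rw [Pi.add_apply, h.1, h.2, add_zero])

theorem bitSupport_single (i : Fin n) : bitSupport (Pi.single i 1 : Bits n) = {i} := by
  ext j
  rw [mem_bitSupport, Finset.mem_singleton]
  by_cases h : j = i
  · subst h
    simp
  · simp [Pi.single_eq_of_ne h, h]

/-! ### Edges and faces -/

theorem vadd_edge (s : Bits n) (i : Fin n) (v : Bits n) :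
    s +ᵥ (cube n).edge i v = (cube n).edge i (s + v) :=
  (translate s).edgeMap_edge i v

theorem vadd_face (s : Bits n) {i j : Fin n} (hij : i ≠ j) (v : Bits n) :
    s +ᵥ (cube n).face hij v = (cube n).face hij (s + v) :=
  (translate s).faceMap_face hij v

namespace ColorHom

variable (f : ColorHom (cube n) A)

/-- An edge is given by its colour and either endpoint, so edges with equal images have equal
colours and some endpoint of one lies in the fibre of an endpoint of the other. -/
theorem isOrbitMap_edgeMap : IsOrbitMap f.code f.edgeMap := by
  constructor
  · intro e
    obtain ⟨i, u, rfl⟩ := A.exists_eq_edge e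
    obtain ⟨v, rfl⟩ := f.toFun_surjective u
    exact ⟨_, f.edgeMap_edge i v⟩
  · intro e e'
    obtain ⟨i, u, rfl⟩ := (cube n).exists_eq_edge e
    obtain ⟨j, v, rfl⟩ := (cube n).exists_eq_edge e'
    constructor
    · intro h
      rw [f.edgeMap_edge, f.edgeMap_edge, A.edge_eq_iff] at h
      obtain ⟨rfl, h⟩ := h
      rw [← f.toFun_nbr] at h
      rcases h with h | h
      · obtain ⟨l, hl⟩ := f.exists_vadd_of_toFun_eq h
        refine ⟨l, (vadd_edge l i u).trans ?_⟩
        rw [hl]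
      · obtain ⟨l, hl⟩ := f.exists_vadd_of_toFun_eq h
        refine ⟨l, (vadd_edge l i u).trans ?_⟩
        rw [hl, (cube n).edge_nbr]
    · rintro ⟨l, hl⟩
      rw [← hl]
      change _ = f.edgeMap ((l : Bits n) +ᵥ (cube n).edge i u)
      rw [vadd_edge, f.edgeMap_edge, f.edgeMap_edge, f.toFun_vadd]

theorem isOrbitMap_faceMap : IsOrbitMap f.code f.faceMap := by
  constructor
  · intro C
    obtain ⟨i, j, hij, u, rfl⟩ := A.exists_eq_face C
    obtain ⟨v, rfl⟩ := f.toFun_surjective u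
    exact ⟨_, f.faceMap_face hij v⟩
  · intro C C'
    obtain ⟨i, j, hij, u, rfl⟩ := (cube n).exists_eq_face C
    obtain ⟨k, l, hkl, v, rfl⟩ := (cube n).exists_eq_face C'
    constructor
    · intro h
      rw [f.faceMap_face, f.faceMap_face] at h
      have h' : A.square i j (f.toFun u) = A.square k l (f.toFun v) := congrArg Subtype.val h
      rw [A.square_eq_iff, ← f.toFun_nbr, ← f.toFun_nbr, ← f.toFun_nbr] at h'
      obtain ⟨hc, h'⟩ := h'
      -- Here `w` is the corner of the second square lying over the same vertex as `u`; a
      -- translation taking `u` to `w` takes one square to the other.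
      have key : ∀ w, f.toFun u = f.toFun w → (w = v ∨ w = (cube n).nbr k v ∨
          w = (cube n).nbr l v ∨ w = (cube n).nbr k ((cube n).nbr l v)) →
          ∃ s : f.code, s +ᵥ (cube n).face hij u = (cube n).face hkl v := by
        intro w hw hwv
        obtain ⟨s, hs⟩ := f.exists_vadd_of_toFun_eq hw
        refine ⟨s, (vadd_face s hij u).trans ?_⟩
        rw [hs]
        exact Subtype.ext ((cube n).square_eq_iff.2 ⟨hc, hwv⟩)
      rcases h' with h' | h' | h' | h'
      · exact key _ h' (Or.inl rfl)
      · exact key _ h' (Or.inr (Or.inl rfl))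
      · exact key _ h' (Or.inr (Or.inr (Or.inl rfl)))
      · exact key _ h' (Or.inr (Or.inr (Or.inr rfl)))
    · rintro ⟨s, hs⟩
      rw [← hs]
      change _ = f.faceMap ((s : Bits n) +ᵥ (cube n).face hij u)
      rw [vadd_face, f.faceMap_face, f.faceMap_face, f.toFun_vadd]

theorem actsFreely_vertices : ActsFreely f.code (Bits n) := by
  intro l v h
  exact Subtype.ext (add_eq_right.1 h)

/-- A translation preserving an edge either fixes its endpoints or swaps them, and a swap would be a
code word of weight 1. -/
theorem actsFreely_edges : ActsFreely f.code (cube n).Edge := by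
  intro l e h
  obtain ⟨i, v, rfl⟩ := (cube n).exists_eq_edge e
  have h' := (vadd_edge l i v).symm.trans h
  rw [(cube n).edge_eq_iff, cube_nbr, add_comm v] at h'
  apply Subtype.ext
  rcases h'.2 with h' | h'
  · exact add_eq_right.1 h'
  · refine f.eq_zero_of_card_le l.2 ?_
    rw [add_right_cancel h', bitSupport_single]
    simp

/-- A translation preserving a square takes a corner to a corner, so its word has weight at most 2.
-/
theorem actsFreely_faces : ActsFreely f.code (cube n).Face := by
  intro l C h
  obtain ⟨i, j, hij, v, hC⟩ := (cube n).exists_eq_face C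
  have hl : (l : Bits n) +ᵥ (cube n).face hij v = (cube n).face hij v := by
    rw [← hC]
    exact h
  rw [vadd_face] at hl
  have h' : (cube n).square i j (l + v) = (cube n).square i j v := congrArg Subtype.val hl
  have h'' := ((cube n).square_eq_iff.1 h').2
  rw [cube_nbr, cube_nbr, cube_nbr, add_assoc v] at h''
  apply Subtype.ext
  have key : ∀ t : Bits n, (bitSupport t).card ≤ 3 → (l : Bits n) + v = v + t →
      (l : Bits n) = 0 := by
    intro t ht hlt
    rw [add_comm v] at hlt
    refine f.eq_zero_of_card_le l.2 ?_
    rwa [add_right_cancel hlt]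
  rcases h'' with h'' | h'' | h'' | h''
  · exact add_eq_right.1 h''
  · exact key _ (by simp [bitSupport_single]) h''
  · exact key _ (by simp [bitSupport_single]) h''
  · refine key _ ?_ h''
    refine (Finset.card_le_card (bitSupport_add_subset _ _)).trans ?_
    rw [bitSupport_single, bitSupport_single]
    exact (Finset.card_union_le _ _).trans (by simp)

end ColorHom

/-! ### Chains -/

theorem IsOrbitMap.range_chainMap {L : Submodule (ZMod 2) (Bits n)} {X Y : Type*}
    [AddAction (Bits n) X] {f : X → Y} (hf : IsOrbitMap L f) :
    LinearMap.range (chainMap f) = ⊤ :=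
  LinearMap.range_eq_top.2 (Finsupp.mapDomain_surjective hf.1)

/-- Choose a representative of each orbit. Replacing every cell by its representative changes a
chain by orbit relations, and it sends a chain of the kernel to 0. -/
theorem IsOrbitMap.ker_chainMap {L : Submodule (ZMod 2) (Bits n)} {X Y : Type*}
    [AddAction (Bits n) X] {f : X → Y} (hf : IsOrbitMap L f) :
    LinearMap.ker (chainMap f) = orbitRelations L X := by
  apply le_antisymm
  · obtain ⟨g, hg⟩ := hf.1.hasRightInverse
    have key : ∀ c : X →₀ ZMod 2,
        c - chainMap g (chainMap f c) ∈ orbitRelations L X := by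
      intro c
      induction c using Finsupp.induction_linear with
      | zero => simp
      | add c d hc hd =>
        rw [map_add, map_add, add_sub_add_comm]
        exact add_mem hc hd
      | single x a =>
        have hx : f (g (f x)) = f x := hg (f x)
        obtain ⟨l, hl⟩ := (hf.2 _ _).1 hx
        have h : chainMap g (chainMap f (Finsupp.single x a)) = Finsupp.single (g (f x)) a := by
          simp [chainMap]
        rw [h, ← mul_one a, ← smul_eq_mul, ← Finsupp.smul_single, ← Finsupp.smul_single,
          ← smul_sub]
        refine Submodule.smul_mem _ _ (Submodule.subset_span ⟨l, g (f x), ?_⟩)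
        rw [hl]
    intro c hc
    have h := key c
    rwa [LinearMap.mem_ker.1 hc, map_zero, sub_zero] at h
  · refine Submodule.span_le.2 ?_
    rintro _ ⟨l, x, rfl⟩
    have h : f (l +ᵥ x) = f x := ((hf.2 x _).2 ⟨l, rfl⟩).symm
    change chainMap f _ = 0
    rw [map_sub]
    simp [chainMap, h]

namespace ColorHom

variable (f : ColorHom (cube n) A)

theorem boundary₁_edge {W : Type*} [Fintype W] [DecidableEq W] (B : Chromotopology n W)
    (i : Fin n) (v : W) :
    B.boundary₁ (Finsupp.single (B.edge i v) 1) =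
      Finsupp.single v 1 + Finsupp.single (B.nbr i v) 1 := by
  simp [Chromotopology.boundary₁, Chromotopology.edge, edgeOf, Sym2.toFinset_mk_eq,
    Finset.sum_pair (B.adj_nbr i v).ne]

theorem chainMap_boundary₁ :
    chainMap f.toFun ∘ₗ (cube n).boundary₁ = A.boundary₁ ∘ₗ chainMap f.edgeMap := by
  refine Finsupp.lhom_ext' fun e => LinearMap.ext_ring ?_
  obtain ⟨i, v, rfl⟩ := (cube n).exists_eq_edge e
  have h : chainMap f.edgeMap (Finsupp.single ((cube n).edge i v) 1) =
      Finsupp.single (A.edge i (f.toFun v)) 1 := by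
    simp [chainMap, f.edgeMap_edge]
  rw [LinearMap.comp_apply, LinearMap.comp_apply, LinearMap.comp_apply, LinearMap.comp_apply,
    Finsupp.lsingle_apply, h, boundary₁_edge, boundary₁_edge, map_add, ← f.toFun_nbr]
  simp [chainMap]

/-- The four edges of a face have distinct images, so nothing cancels modulo 2. -/
theorem chainMap_boundary₂ :
    chainMap f.edgeMap ∘ₗ (cube n).boundary₂ = A.boundary₂ ∘ₗ chainMap f.faceMap := by
  refine Finsupp.lhom_ext' fun C => LinearMap.ext_ring ?_
  have h : chainMap f.faceMap (Finsupp.single C 1) = Finsupp.single (f.faceMap C) 1 := by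
    simp [chainMap]
  rw [LinearMap.comp_apply, LinearMap.comp_apply, LinearMap.comp_apply, LinearMap.comp_apply,
    Finsupp.lsingle_apply, h]
  simp only [Chromotopology.boundary₂, Finsupp.linearCombination_single, one_smul, map_sum]
  change _ = ∑ e ∈ C.1.image f.edgeMap, _
  rw [Finset.sum_image (f.edgeMap_injOn C)]
  simp [chainMap]

end ColorHom

end Codes

/-! ### Closed cells as point sets and their images. -/

section Cells

variable {n : ℕ} {V W : Type*} [Fintype V] [DecidableEq V] [Fintype W] [DecidableEq W]

/-! ### Parametrizations of the cells -/

namespace Chromotopology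

variable (A : Chromotopology n V)

/-- The definition allows both orders of the endpoints; reversing them replaces `t` by `1 - t`, so
one parametrization suffices. -/
theorem mem_edgeCell {i : Fin n} {v : V} {w : V → ℝ} :
    w ∈ A.edgeCell (A.edge i v) ↔ ∃ t ∈ Set.Icc (0 : ℝ) 1,
      w = (1 - t) • Pi.single v 1 + t • Pi.single (A.nbr i v) 1 := by
  constructor
  · rintro ⟨a, b, hab, t, ht, rfl⟩
    change s(v, A.nbr i v) = s(a, b) at hab
    rcases Sym2.eq_iff.1 hab with ⟨rfl, rfl⟩ | ⟨rfl, rfl⟩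
    · exact ⟨t, ht, rfl⟩
    · exact ⟨1 - t, ⟨by linarith [ht.2], by linarith [ht.1]⟩, by rw [sub_sub_cancel, add_comm]⟩
  · rintro ⟨t, ht, rfl⟩
    exact ⟨v, A.nbr i v, rfl, t, ht, rfl⟩

/-- The closed square of colours `i` and `j` at `v`. -/
def squareCell (i j : Fin n) (v : V) : Set (V → ℝ) :=
  {w | ∃ x ∈ Set.Icc (0 : ℝ) 1, ∃ y ∈ Set.Icc (0 : ℝ) 1,
    w = squarePoint v (A.nbr i v) (A.nbr j (A.nbr i v)) (A.nbr j v) x y}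

theorem squareCell_comm (i j : Fin n) (v : V) : A.squareCell i j v = A.squareCell j i v := by
  have h : ∀ i j, A.squareCell i j v ⊆ A.squareCell j i v := by
    rintro i j _ ⟨x, hx, y, hy, rfl⟩
    refine ⟨y, hy, x, hx, ?_⟩
    rw [A.nbr_comm j i]
    unfold squarePoint
    module
  exact (h i j).antisymm (h j i)

theorem squareCell_nbr_left (i j : Fin n) (v : V) :
    A.squareCell i j (A.nbr i v) = A.squareCell i j v := by
  have h : ∀ v, A.squareCell i j (A.nbr i v) ⊆ A.squareCell i j v := by
    rintro v _ ⟨x, hx, y, hy, rfl⟩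
    refine ⟨1 - x, ⟨by linarith [hx.2], by linarith [hx.1]⟩, y, hy, ?_⟩
    rw [A.nbr_nbr]
    unfold squarePoint
    module
  refine (h v).antisymm ?_
  have h' := h (A.nbr i v)
  rwa [A.nbr_nbr] at h'

/-- Exchanging the two parameters and reflecting them relates all labellings of the corners, so the
parametrized set depends only on the cycle. -/
theorem squareCell_eq {i j k l : Fin n} {u v : V} (h : A.square i j u = A.square k l v) :
    A.squareCell i j u = A.squareCell k l v := by
  obtain ⟨hc, hv⟩ := A.square_eq_iff.1 h
  have h1 : A.squareCell i j u = A.squareCell k l u := by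
    rcases hc with ⟨rfl, rfl⟩ | ⟨rfl, rfl⟩
    · rfl
    · exact A.squareCell_comm _ _ _
  have right : ∀ v, A.squareCell k l (A.nbr l v) = A.squareCell k l v := fun v => by
    rw [A.squareCell_comm, A.squareCell_nbr_left, A.squareCell_comm]
  rw [h1]
  rcases hv with rfl | rfl | rfl | rfl
  · rfl
  · exact A.squareCell_nbr_left k l v
  · exact right v
  · rw [A.squareCell_nbr_left, right]

theorem faceCell_face {i j : Fin n} (hij : i ≠ j) (v : V) :
    A.faceCell (A.face hij v) = A.squareCell i j v := by
  ext w
  constructor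
  · rintro ⟨a, b, c, d, hab, hbc, hcd, hda, hac, hbd, hC, x, hx, y, hy, rfl⟩
    obtain ⟨k, l, -, rfl, rfl, rfl, h⟩ := A.face_corners _ hac hbd hC
    have h' : A.square i j v = A.square k l a := h
    rw [A.squareCell_eq h']
    exact ⟨x, hx, y, hy, rfl⟩
  · rintro ⟨x, hx, y, hy, rfl⟩
    exact ⟨_, _, _, _, _, _, _, _, (A.nbr_nbr_ne hij.symm v).symm,
      fun h => hij (A.nbr_eq_nbr_iff.1 h), A.square_eq_cycleEdges i j v, x, hx, y, hy, rfl⟩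

/-- The points of the square complex of `A`. -/
def carrier : Set (V → ℝ) :=
  {w | (∃ v, w ∈ vertexCell v) ∨ (∃ e, w ∈ A.edgeCell e) ∨ ∃ C, w ∈ A.faceCell C}

theorem mem_carrier {w : V → ℝ} : w ∈ A.carrier ↔ (∃ v, w = Pi.single v 1) ∨
    (∃ i v, w ∈ A.edgeCell (A.edge i v)) ∨
    ∃ i j v, i ≠ j ∧ w ∈ A.squareCell i j v := by
  refine or_congr Iff.rfl (or_congr ?_ ?_)
  · constructor
    · rintro ⟨e, he⟩
      obtain ⟨i, v, rfl⟩ := A.exists_eq_edge e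
      exact ⟨i, v, he⟩
    · rintro ⟨i, v, h⟩
      exact ⟨_, h⟩
  · constructor
    · rintro ⟨C, hC⟩
      obtain ⟨i, j, hij, v, rfl⟩ := A.exists_eq_face C
      rw [A.faceCell_face] at hC
      exact ⟨i, j, v, hij, hC⟩
    · rintro ⟨i, j, v, hij, h⟩
      rw [← A.faceCell_face hij] at h
      exact ⟨_, h⟩

theorem continuous_squarePoint (a b c d : V) :
    Continuous fun q : ℝ × ℝ => squarePoint a b c d q.1 q.2 := by
  unfold squarePoint
  fun_prop

/-- There are finitely many cells, each a continuous image of a compact set. With the Hausdorff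
property this makes continuous maps between these spaces closed. -/
theorem isCompact_carrier : IsCompact A.carrier := by
  have h : A.carrier = (⋃ v, vertexCell v) ∪ ((⋃ e, A.edgeCell e) ∪ ⋃ C, A.faceCell C) := by
    ext w
    simp [carrier]
  rw [h]
  refine (isCompact_iUnion fun v => isCompact_singleton).union
    ((isCompact_iUnion fun e => ?_).union (isCompact_iUnion fun C => ?_))
  · obtain ⟨i, v, rfl⟩ := A.exists_eq_edge e
    have he : A.edgeCell (A.edge i v) = (fun t : ℝ => (1 - t) • (Pi.single v 1 : V → ℝ) +
        t • Pi.single (A.nbr i v) 1) '' Set.Icc 0 1 := by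
      ext w
      rw [A.mem_edgeCell]
      exact ⟨fun ⟨t, ht, h⟩ => ⟨t, ht, h.symm⟩, fun ⟨t, ht, h⟩ => ⟨t, ht, h.symm⟩⟩
    rw [he]
    exact isCompact_Icc.image (by fun_prop)
  · obtain ⟨i, j, hij, v, rfl⟩ := A.exists_eq_face C
    have hC : A.faceCell (A.face hij v) = (fun q : ℝ × ℝ => squarePoint v (A.nbr i v)
        (A.nbr j (A.nbr i v)) (A.nbr j v) q.1 q.2) '' (Set.Icc 0 1 ×ˢ Set.Icc 0 1) := by
      rw [A.faceCell_face]
      ext w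
      constructor
      · rintro ⟨x, hx, y, hy, rfl⟩
        exact ⟨(x, y), ⟨hx, hy⟩, rfl⟩
      · rintro ⟨⟨x, y⟩, ⟨hx, hy⟩, rfl⟩
        exact ⟨x, hx, y, hy, rfl⟩
    rw [hC]
    exact (isCompact_Icc.prod isCompact_Icc).image (continuous_squarePoint _ _ _ _)

instance : CompactSpace A.Space := isCompact_iff_compactSpace.1 A.isCompact_carrier

instance : T2Space A.Space := inferInstanceAs (T2Space {_w : V → ℝ // _})

end Chromotopology

namespace ColorHom

variable {A : Chromotopology n V} {B : Chromotopology n W} (f : ColorHom A B)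

theorem spaceMap_image {s : Set (V → ℝ)} {t : Set (W → ℝ)} (hs : s ⊆ A.carrier)
    (h : pushWeights f.toFun '' s = t) : f.spaceMap '' A.inSpace s = B.inSpace t := by
  subst h
  ext y
  constructor
  · rintro ⟨x, hx, rfl⟩
    exact ⟨x.1, hx, rfl⟩
  · rintro ⟨w, hw, hy⟩
    exact ⟨⟨w, hs hw⟩, hw, Subtype.ext hy⟩

theorem spaceMap_image_vertexCell (v : V) :
    f.spaceMap '' A.inSpace (vertexCell v) = B.inSpace (vertexCell (f.toFun v)) := by
  refine f.spaceMap_image (fun w hw => Or.inl ⟨v, hw⟩) ?_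
  rw [vertexCell, Set.image_singleton, pushWeights_single]
  rfl

theorem spaceMap_image_edgeCell (e : A.Edge) :
    f.spaceMap '' A.inSpace (A.edgeCell e) = B.inSpace (B.edgeCell (f.edgeMap e)) := by
  refine f.spaceMap_image (fun w hw => Or.inr (Or.inl ⟨e, hw⟩)) ?_
  obtain ⟨i, v, rfl⟩ := A.exists_eq_edge e
  have push : ∀ t : ℝ, pushWeights f.toFun
      ((1 - t) • Pi.single v 1 + t • Pi.single (A.nbr i v) 1) =
      (1 - t) • Pi.single (f.toFun v) 1 + t • Pi.single (B.nbr i (f.toFun v)) 1 := fun t => by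
    simp only [pushWeights_add, pushWeights_smul, pushWeights_single, f.toFun_nbr]
  rw [f.edgeMap_edge]
  ext w
  rw [B.mem_edgeCell]
  constructor
  · rintro ⟨w, hw, rfl⟩
    obtain ⟨t, ht, rfl⟩ := A.mem_edgeCell.1 hw
    exact ⟨t, ht, push t⟩
  · rintro ⟨t, ht, rfl⟩
    exact ⟨_, A.mem_edgeCell.2 ⟨t, ht, rfl⟩, push t⟩

theorem spaceMap_image_faceCell (C : A.Face) :
    f.spaceMap '' A.inSpace (A.faceCell C) = B.inSpace (B.faceCell (f.faceMap C)) := by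
  refine f.spaceMap_image (fun w hw => Or.inr (Or.inr ⟨C, hw⟩)) ?_
  obtain ⟨i, j, hij, v, rfl⟩ := A.exists_eq_face C
  rw [f.faceMap_face, B.faceCell_face, A.faceCell_face]
  ext w
  constructor
  · rintro ⟨_, ⟨x, hx, y, hy, rfl⟩, rfl⟩
    refine ⟨x, hx, y, hy, ?_⟩
    rw [pushWeights_squarePoint, f.toFun_nbr, f.toFun_nbr, f.toFun_nbr, f.toFun_nbr]
  · rintro ⟨x, hx, y, hy, rfl⟩
    refine ⟨_, ⟨x, hx, y, hy, rfl⟩, ?_⟩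
    rw [pushWeights_squarePoint, f.toFun_nbr, f.toFun_nbr, f.toFun_nbr, f.toFun_nbr]

theorem spaceMap_surjective (hv : Function.Surjective f.toFun)
    (he : Function.Surjective f.edgeMap) (hC : Function.Surjective f.faceMap) :
    Function.Surjective f.spaceMap := by
  intro y
  rcases y.2 with ⟨v, h⟩ | ⟨e, h⟩ | ⟨C, h⟩
  · obtain ⟨v, rfl⟩ := hv v
    have h' : y ∈ B.inSpace (vertexCell (f.toFun v)) := h
    rw [← f.spaceMap_image_vertexCell] at h'
    exact Set.mem_range_of_mem_image _ _ h'
  · obtain ⟨e, rfl⟩ := he e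
    have h' : y ∈ B.inSpace (B.edgeCell (f.edgeMap e)) := h
    rw [← f.spaceMap_image_edgeCell] at h'
    exact Set.mem_range_of_mem_image _ _ h'
  · obtain ⟨C, rfl⟩ := hC C
    have h' : y ∈ B.inSpace (B.faceCell (f.faceMap C)) := h
    rw [← f.spaceMap_image_faceCell] at h'
    exact Set.mem_range_of_mem_image _ _ h'

end ColorHom

end Cells

/-! ### The square complex of the cube as a skeleton of the solid cube -/

section Weights

variable {n : ℕ}

/-- The vertex of the solid cube that corresponds to a bitstring. -/
def bitPoint (v : Bits n) : Fin n → ℝ := fun i => if v i = 0 then 0 else 1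

/-- The multilinear weights on the vertices of the cube whose barycentre is `p`. -/
def cubeWeights (p : Fin n → ℝ) : Bits n → ℝ := fun v => ∏ i, if v i = 0 then 1 - p i else p i

/-- The barycentre of the weights `w` on the vertices of the cube. -/
def barycentre (w : Bits n → ℝ) : Fin n → ℝ := fun i => ∑ v, w v * bitPoint v i

theorem continuous_cubeWeights : Continuous (cubeWeights (n := n)) := by
  refine continuous_pi fun v => continuous_finsetProd _ fun i _ => ?_
  split_ifs <;> fun_prop

theorem continuous_barycentre : Continuous (barycentre (n := n)) := by
  unfold barycentre
  fun_prop

/-- For `p` in the unit cube, the weights are the law of independent bits with means `p i`, and the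
barycentre is the vector of means; as an algebraic identity this holds for every `p`. -/
theorem barycentre_cubeWeights (p : Fin n → ℝ) : barycentre (cubeWeights p) = p := by
  funext i
  -- The indicator of the bit `i` is absorbed into the factor at `k = i`, so that the sum over
  -- bitstrings becomes a product of sums over single bits.
  let g (k : Fin n) (a : ZMod 2) : ℝ :=
    (if a = 0 then 1 - p k else p k) * if k = i ∧ a = 0 then 0 else 1
  have h1 : ∀ v : Bits n, cubeWeights p v * bitPoint v i = ∏ k, g k (v k) := by
    intro v
    rw [Finset.prod_mul_distrib]
    congr 1
    rw [Finset.prod_eq_single i]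
    · simp [bitPoint]
    · intro k _ hk
      simp [hk]
    · simp
  have h2 : ∀ k, ∑ a, g k a = if k = i then p k else 1 := by
    intro k
    have huniv : (Finset.univ : Finset (ZMod 2)) = {0, 1} := by decide
    rw [huniv, Finset.sum_pair (by decide)]
    by_cases hk : k = i <;> simp [g, hk]
  change ∑ v, cubeWeights p v * bitPoint v i = p i
  rw [Finset.sum_congr rfl fun v _ => h1 v, ← Fintype.prod_sum, Finset.prod_congr rfl fun k _ => h2 k]
  simp

/-- Only one factor of the product involves the coordinate `i`, and it is affine. Hence edges of the
solid cube go to segments and its square faces to bilinear squares. -/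
theorem cubeWeights_update (p : Fin n → ℝ) (i : Fin n) {r s : ℝ} (hrs : r + s = 1) (a b : ℝ) :
    cubeWeights (Function.update p i (r * a + s * b)) =
      r • cubeWeights (Function.update p i a) + s • cubeWeights (Function.update p i b) := by
  have h : ∀ (t : ℝ) (v : Bits n), cubeWeights (Function.update p i t) v =
      (if v i = 0 then 1 - t else t) *
        ∏ k ∈ Finset.univ.erase i, if v k = 0 then 1 - p k else p k := by
    intro t v
    rw [cubeWeights, ← Finset.mul_prod_erase _ _ (Finset.mem_univ i), Function.update_self]
    congr 1
    refine Finset.prod_congr rfl fun k hk => ?_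
    rw [Function.update_of_ne (Finset.ne_of_mem_erase hk)]
  have hr : r = 1 - s := by linarith
  subst hr
  funext v
  rw [Pi.add_apply, Pi.smul_apply, Pi.smul_apply, h, h, h, smul_eq_mul, smul_eq_mul]
  split_ifs <;> ring

theorem cubeWeights_bitPoint (v : Bits n) : cubeWeights (bitPoint v) = Pi.single v 1 := by
  have h01 : ∀ a b : ZMod 2, a ≠ 0 → b ≠ 0 → a = b := by decide
  funext u
  by_cases h : u = v
  · subst h
    rw [Pi.single_eq_same]
    refine Finset.prod_eq_one fun i _ => ?_
    by_cases hi : u i = 0 <;> simp [bitPoint, hi]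
  · rw [Pi.single_eq_of_ne h]
    obtain ⟨i, hi⟩ := Function.ne_iff.1 h
    refine Finset.prod_eq_zero (Finset.mem_univ i) ?_
    by_cases hu : u i = 0
    · simp [bitPoint, hu, show v i ≠ 0 from fun h' => hi (hu.trans h'.symm)]
    · have hv : v i = 0 := by
        by_contra hv
        exact hi (h01 _ _ hu hv)
      simp [bitPoint, hu, hv]

theorem update_bitPoint (v : Bits n) (i : Fin n) :
    Function.update (bitPoint v) i (1 - bitPoint v i) = bitPoint (v + Pi.single i 1) := by
  have h01 : ∀ a : ZMod 2, a ≠ 0 → a + 1 = 0 := by decide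
  funext k
  by_cases hk : k = i
  · subst hk
    rw [Function.update_self]
    by_cases h : v k = 0
    · simp [bitPoint, h]
    · simp [bitPoint, h, h01 _ h]
  · rw [Function.update_of_ne hk]
    simp [bitPoint, Pi.single_eq_of_ne hk]

/-- The coordinate that is reached from the vertex `v` after moving by `t` in direction `i`. -/
def moveCoord (v : Bits n) (i : Fin n) (t : ℝ) : ℝ :=
  (1 - t) * bitPoint v i + t * (1 - bitPoint v i)

theorem cubeWeights_edge (v : Bits n) (i : Fin n) (t : ℝ) :
    cubeWeights (Function.update (bitPoint v) i (moveCoord v i t)) =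
      (1 - t) • Pi.single v 1 + t • Pi.single ((cube n).nbr i v) 1 := by
  rw [moveCoord, cubeWeights_update _ _ (by ring), Function.update_eq_self, update_bitPoint,
    cubeWeights_bitPoint, cubeWeights_bitPoint, cube_nbr]

theorem cubeWeights_square (v : Bits n) {i j : Fin n} (hij : i ≠ j) (x y : ℝ) :
    cubeWeights (Function.update (Function.update (bitPoint v) i (moveCoord v i x)) j
      (moveCoord v j y)) =
      squarePoint v ((cube n).nbr i v) ((cube n).nbr j ((cube n).nbr i v)) ((cube n).nbr j v) x y := by
  have h1 : Function.update (Function.update (bitPoint v) i (moveCoord v i x)) j (bitPoint v j) =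
      Function.update (bitPoint v) i (moveCoord v i x) := by
    rw [Function.update_comm hij, Function.update_eq_self]
  have h2 : Function.update (Function.update (bitPoint v) i (moveCoord v i x)) j
      (1 - bitPoint v j) = Function.update (bitPoint ((cube n).nbr j v)) i
        (moveCoord ((cube n).nbr j v) i x) := by
    rw [Function.update_comm hij, update_bitPoint, cube_nbr]
    congr 1
    simp [moveCoord, bitPoint, Pi.single_eq_of_ne hij]
  have h3 : moveCoord v j y = (1 - y) * bitPoint v j + y * (1 - bitPoint v j) := rfl
  rw [h3, cubeWeights_update _ _ (by ring), h1, h2, cubeWeights_edge, cubeWeights_edge,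
    (cube n).nbr_comm j i]
  unfold squarePoint
  module

theorem moveCoord_mem (v : Bits n) (i : Fin n) {t : ℝ} (ht : t ∈ Set.Icc (0 : ℝ) 1) :
    moveCoord v i t ∈ Set.Icc (0 : ℝ) 1 := by
  obtain ⟨h0, h1⟩ := ht
  unfold moveCoord bitPoint
  split_ifs <;> constructor <;> linarith

theorem bitPoint_mem (v : Bits n) (k : ℕ) : bitPoint v ∈ cubeSkeleton k Finset.univ := by
  refine ⟨fun i => ?_, fun i hi => absurd (Finset.mem_univ i) hi, ?_⟩
  · unfold bitPoint
    split_ifs <;> simp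
  · have h : fracCoords (bitPoint v) = ∅ := by
      ext i
      simp only [mem_fracCoords, bitPoint]
      split_ifs <;> simp
    simp [h]

theorem update_mem_cubeSkeleton_succ {k : ℕ} {p : Fin n → ℝ}
    (hp : p ∈ cubeSkeleton k Finset.univ) (i : Fin n) {t : ℝ} (ht : t ∈ Set.Icc (0 : ℝ) 1) :
    Function.update p i t ∈ cubeSkeleton (k + 1) Finset.univ :=
  update_mem_cubeSkeleton (k := k + 1) (J := Finset.univ) ⟨hp.1, hp.2.1, hp.2.2.trans (Nat.le_succ k)⟩
    (fun j hj => absurd (Finset.mem_univ j) hj) ht (Or.inl (Finset.mem_univ i))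
    ((Finset.card_le_card (fracCoords_update_subset _ _ _)).trans
      ((Finset.card_insert_le _ _).trans (Nat.succ_le_succ hp.2.2)))

theorem cubeSkeleton_mono {k k' : ℕ} (h : k ≤ k') (J : Finset (Fin n)) :
    cubeSkeleton k J ⊆ cubeSkeleton k' J := fun _ hp => ⟨hp.1, hp.2.1, hp.2.2.trans h⟩

/-- A vertex of the smallest face of the solid cube that contains `p`. -/
def roundBits (p : Fin n → ℝ) : Bits n := fun i => if p i = 1 then 1 else 0

theorem bitPoint_roundBits_of_notMem {p : Fin n → ℝ} {i : Fin n} (hi : i ∉ fracCoords p) :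
    bitPoint (roundBits p) i = p i := by
  rw [mem_fracCoords] at hi
  by_cases h : p i = 1
  · simp [bitPoint, roundBits, h]
  · have h0 : p i = 0 := by tauto
    simp [bitPoint, roundBits, h0]

/-- A fractional coordinate rounds to 0, so the coordinate itself is the parameter along the cell.
-/
theorem moveCoord_roundBits {p : Fin n → ℝ} {i : Fin n} (hi : i ∈ fracCoords p) :
    moveCoord (roundBits p) i (p i) = p i := by
  simp [moveCoord, bitPoint, roundBits, (mem_fracCoords.1 hi).2]

/-- A point of the skeleton with 0, 1 or 2 fractional coordinates lies on the vertex, edge or square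
that leaves `roundBits p` in the fractional directions. -/
theorem image_cubeWeights :
    cubeWeights '' cubeSkeleton 2 Finset.univ = (cube n).carrier := by
  ext w
  rw [Chromotopology.mem_carrier]
  constructor
  · rintro ⟨p, hp, rfl⟩
    have hcard := hp.2.2
    interval_cases h : (fracCoords p).card
    · left
      refine ⟨roundBits p, ?_⟩
      rw [← cubeWeights_bitPoint]
      congr 1
      funext k
      rw [bitPoint_roundBits_of_notMem]
      simp [Finset.card_eq_zero.1 h]
    · right
      left
      obtain ⟨i, hi⟩ := Finset.card_eq_one.1 h
      refine ⟨i, roundBits p, (cube n).mem_edgeCell.2 ⟨p i, hp.1 i, ?_⟩⟩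
      rw [← cubeWeights_edge, moveCoord_roundBits (by simp [hi])]
      congr 1
      funext k
      by_cases hk : k = i
      · subst hk
        rw [Function.update_self]
      · rw [Function.update_of_ne hk, bitPoint_roundBits_of_notMem (by simp [hi, hk])]
    · right
      right
      obtain ⟨i, j, hij, hi⟩ := Finset.card_eq_two.1 h
      refine ⟨i, j, roundBits p, hij, p i, hp.1 i, p j, hp.1 j, ?_⟩
      rw [← cubeWeights_square _ hij, moveCoord_roundBits (by simp [hi]),
        moveCoord_roundBits (by simp [hi])]
      congr 1
      funext k
      by_cases hk : k = j
      · subst hk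
        rw [Function.update_self]
      · rw [Function.update_of_ne hk]
        by_cases hk' : k = i
        · subst hk'
          rw [Function.update_self]
        · rw [Function.update_of_ne hk', bitPoint_roundBits_of_notMem (by simp [hi, hk, hk'])]
  · rintro (⟨v, rfl⟩ | ⟨i, v, hw⟩ | ⟨i, j, v, hij, x, hx, y, hy, rfl⟩)
    · exact ⟨_, bitPoint_mem v 2, cubeWeights_bitPoint v⟩
    · obtain ⟨t, ht, rfl⟩ := (cube n).mem_edgeCell.1 hw
      exact ⟨_, cubeSkeleton_mono (by norm_num) _
        (update_mem_cubeSkeleton_succ (bitPoint_mem v 0) i (moveCoord_mem v i ht)),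
        cubeWeights_edge v i t⟩
    · exact ⟨_, update_mem_cubeSkeleton_succ
        (update_mem_cubeSkeleton_succ (bitPoint_mem v 0) i (moveCoord_mem v i hx)) j
        (moveCoord_mem v j hy), cubeWeights_square v hij x y⟩

theorem exists_cubeWeights (x : (cube n).Space) :
    ∃ p ∈ cubeSkeleton 2 Finset.univ, cubeWeights p = x.1 := image_cubeWeights.symm.subset x.2

theorem barycentre_mem (x : (cube n).Space) : barycentre x.1 ∈ cubeSkeleton 2 Finset.univ := by
  obtain ⟨p, hp, h⟩ := exists_cubeWeights x
  rwa [← h, barycentre_cubeWeights]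

theorem cubeWeights_barycentre (x : (cube n).Space) : cubeWeights (barycentre x.1) = x.1 := by
  obtain ⟨p, hp, h⟩ := exists_cubeWeights x
  rw [← h, barycentre_cubeWeights]

/-- The square complex of the cube is the `2`-skeleton of the solid cube. -/
def cubeSpaceHomeomorph : (cube n).Space ≃ₜ cubeSkeleton 2 (Finset.univ : Finset (Fin n)) where
  toFun x := ⟨barycentre x.1, barycentre_mem x⟩
  invFun p := ⟨cubeWeights p.1, image_cubeWeights.subset ⟨p.1, p.2, rfl⟩⟩
  left_inv x := Subtype.ext (cubeWeights_barycentre x)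
  right_inv p := Subtype.ext (barycentre_cubeWeights p.1)
  continuous_toFun := (continuous_barycentre.comp continuous_subtype_val).subtype_mk _
  continuous_invFun := (continuous_cubeWeights.comp continuous_subtype_val).subtype_mk _

theorem simplyConnectedSpace_cube : SimplyConnectedSpace (cube n).Space := by
  have := simplyConnectedSpace_cubeSkeleton (Finset.univ : Finset (Fin n))
  exact cubeSpaceHomeomorph.toHomotopyEquiv.simplyConnectedSpace

end Weights

/-! ### Fibres on points, the covering map and its deck transformations. -/

section Orbits

variable {n : ℕ} {V : Type*} [Fintype V] [DecidableEq V] {A : Chromotopology n V}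

/-! ### Supports of weights -/

theorem cubeWeights_nonneg {p : Fin n → ℝ} (hp : ∀ i, p i ∈ Set.Icc (0 : ℝ) 1) (v : Bits n) :
    0 ≤ cubeWeights p v := by
  refine Finset.prod_nonneg fun i _ => ?_
  split_ifs
  · linarith [(hp i).2]
  · exact (hp i).1

/-- A factor of the product vanishes only where the coordinate is 0 or 1 and the bit disagrees with
it. -/
theorem cubeWeights_ne_zero_iff {p : Fin n → ℝ} {v : Bits n} :
    cubeWeights p v ≠ 0 ↔ ∀ i ∉ fracCoords p, v i = roundBits p i := by
  have h01 : ∀ a : ZMod 2, a ≠ 0 → a = 1 := by decide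
  rw [cubeWeights, Finset.prod_ne_zero_iff]
  refine forall_congr' fun i => ?_
  simp only [Finset.mem_univ, true_implies, mem_fracCoords, roundBits]
  by_cases h0 : p i = 0
  · by_cases hv : v i = 0 <;> simp [h0, hv]
  · by_cases h1 : p i = 1
    · by_cases hv : v i = 0
      · simp [h1, hv]
      · simp [h1, hv, h01 _ hv]
    · have h1' : 1 - p i ≠ 0 := sub_ne_zero.2 (Ne.symm h1)
      by_cases hv : v i = 0 <;> simp [h0, h1, hv, h1']

theorem cubeWeights_roundBits (p : Fin n → ℝ) : cubeWeights p (roundBits p) ≠ 0 :=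
  cubeWeights_ne_zero_iff.2 fun _ _ => rfl

/-- The support of the weights at `p` consists of the vertices of a face. -/
theorem cubeWeights_ne_zero_iff_of_ne_zero {p : Fin n → ℝ} {u v : Bits n}
    (hv : cubeWeights p v ≠ 0) :
    cubeWeights p u ≠ 0 ↔ bitSupport (u - v) ⊆ fracCoords p := by
  rw [cubeWeights_ne_zero_iff] at hv ⊢
  constructor
  · intro hu i hi
    by_contra h
    rw [mem_bitSupport, Pi.sub_apply, hu i h, hv i h, sub_self] at hi
    exact hi rfl
  · intro h i hi
    rw [← hv i hi]
    by_contra hne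
    exact hi (h (mem_bitSupport.2 (sub_ne_zero.2 hne)))

/-- Nonnegative weights cannot cancel within a fibre. -/
theorem pushWeights_apply_ne_zero {W : Type*} [Fintype W] [DecidableEq W] {f : W → V}
    {w : W → ℝ} (hw : ∀ v, 0 ≤ w v) {v : W} (hv : w v ≠ 0) : pushWeights f w (f v) ≠ 0 := by
  have h : w v ≤ pushWeights f w (f v) :=
    Finset.single_le_sum (f := w) (fun u _ => hw u) (by simp)
  have h' : 0 < w v := lt_of_le_of_ne (hw v) hv.symm
  linarith

theorem exists_of_pushWeights_ne_zero {W : Type*} [Fintype W] [DecidableEq W] {f : W → V}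
    {w : W → ℝ} {u : V} (h : pushWeights f w u ≠ 0) : ∃ v, f v = u ∧ w v ≠ 0 := by
  obtain ⟨v, hv, hne⟩ := Finset.exists_ne_zero_of_sum_ne_zero h
  exact ⟨v, (Finset.mem_filter.1 hv).2, hne⟩

namespace ColorHom

variable (f : ColorHom (cube n) A)

/-- From the common vertex `v`, step in a fractional direction of `p`. The image of the new vertex
is also the image of a vertex in the support of `q`, and these two vertices differ by a code word of
weight at most 1 + 2 = 3. So they are equal, and the direction is fractional for `q`. -/
theorem fracCoords_subset_of_pushWeights_eq {p q : Fin n → ℝ}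
    (hp : p ∈ cubeSkeleton 2 Finset.univ) (hq : q ∈ cubeSkeleton 2 Finset.univ) {v : Bits n}
    (hpv : cubeWeights p v ≠ 0) (hqv : cubeWeights q v ≠ 0)
    (h : pushWeights f.toFun (cubeWeights p) = pushWeights f.toFun (cubeWeights q)) :
    fracCoords p ⊆ fracCoords q := by
  intro i hi
  have h1 : cubeWeights p (v + Pi.single i 1) ≠ 0 := by
    rw [cubeWeights_ne_zero_iff_of_ne_zero hpv, add_sub_cancel_left, bitSupport_single]
    simpa using hi
  have h2 := pushWeights_apply_ne_zero (f := f.toFun) (cubeWeights_nonneg hp.1) h1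
  rw [h] at h2
  obtain ⟨u, hu, hu0⟩ := exists_of_pushWeights_ne_zero h2
  have h3 := (cubeWeights_ne_zero_iff_of_ne_zero hqv).1 hu0
  have h4 : u - (v + Pi.single i 1) = 0 := by
    refine f.eq_zero_of_card_le (f.toFun_eq_iff.1 hu) ?_
    have h5 : u - (v + Pi.single i 1) = (u - v) + Pi.single i 1 := by
      have h6 : -(Pi.single i 1 : Bits n) = Pi.single i 1 := by
        rw [← Pi.single_neg]
        rfl
      rw [← sub_sub, sub_eq_add_neg (u - v), h6]
    rw [h5]
    refine (Finset.card_le_card (bitSupport_add_subset _ _)).trans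
      ((Finset.card_union_le _ _).trans ?_)
    rw [bitSupport_single, Finset.card_singleton]
    exact Nat.succ_le_succ ((Finset.card_le_card h3).trans hq.2.2)
  rw [sub_eq_zero.1 h4, add_sub_cancel_left, bitSupport_single] at h3
  exact h3 (Finset.mem_singleton_self i)

/-- The two supports are the same face. Its vertices differ pairwise in at most two bits, so `f` is
injective on it and the weights can be read off from their images. -/
theorem cubeWeights_eq_of_pushWeights_eq {p q : Fin n → ℝ}
    (hp : p ∈ cubeSkeleton 2 Finset.univ) (hq : q ∈ cubeSkeleton 2 Finset.univ) {v : Bits n}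
    (hpv : cubeWeights p v ≠ 0) (hqv : cubeWeights q v ≠ 0)
    (h : pushWeights f.toFun (cubeWeights p) = pushWeights f.toFun (cubeWeights q)) :
    cubeWeights p = cubeWeights q := by
  have hfrac : fracCoords p = fracCoords q :=
    (f.fracCoords_subset_of_pushWeights_eq hp hq hpv hqv h).antisymm
      (f.fracCoords_subset_of_pushWeights_eq hq hp hqv hpv h.symm)
  have push : ∀ r ∈ cubeSkeleton 2 Finset.univ, cubeWeights r v ≠ 0 → ∀ u,
      bitSupport (u - v) ⊆ fracCoords r →
      pushWeights f.toFun (cubeWeights r) (f.toFun u) = cubeWeights r u := by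
    intro r hr hrv u hu
    refine Finset.sum_eq_single u ?_ (by simp)
    intro u' hu' hne
    by_contra h0
    have h1 := (cubeWeights_ne_zero_iff_of_ne_zero hrv).1 h0
    have h2 := (cubeWeights_ne_zero_iff_of_ne_zero h0).1
      ((cubeWeights_ne_zero_iff_of_ne_zero hrv).2 hu)
    refine hne (sub_eq_zero.1 (f.eq_zero_of_card_le (l := u - u') ?_ ?_)).symm
    · exact f.toFun_eq_iff.1 (Finset.mem_filter.1 hu').2.symm
    · exact ((Finset.card_le_card h2).trans hr.2.2).trans (by norm_num)
  funext u
  by_cases hu : bitSupport (u - v) ⊆ fracCoords p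
  · rw [← push p hp hpv u hu, h, push q hq hqv u (hfrac ▸ hu)]
  · have h1 : cubeWeights p u = 0 :=
      not_not.1 fun h' => hu ((cubeWeights_ne_zero_iff_of_ne_zero hpv).1 h')
    have h2 : cubeWeights q u = 0 :=
      not_not.1 fun h' => hu (hfrac ▸ (cubeWeights_ne_zero_iff_of_ne_zero hqv).1 h')
    rw [h1, h2]

end ColorHom

/-! ### The action on the square complex of the cube -/

theorem val_vadd_space (s : Bits n) (x : (cube n).Space) :
    (s +ᵥ x).1 = pushWeights (fun v : Bits n => s + v) x.1 := rfl

theorem vadd_space_apply (s : Bits n) (x : (cube n).Space) (v : Bits n) :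
    (s +ᵥ x).1 (s + v) = x.1 v := by
  rw [val_vadd_space]
  refine (Finset.sum_eq_single v ?_ (by simp)).trans rfl
  intro u hu hne
  exact absurd (add_left_cancel (Finset.mem_filter.1 hu).2) hne

instance (L : Submodule (ZMod 2) (Bits n)) : ContinuousConstVAdd L (cube n).Space :=
  ⟨fun l => (translate (l : Bits n)).continuous_spaceMap⟩

namespace ColorHom

variable (f : ColorHom (cube n) A)

theorem spaceMap_vadd (l : f.code) (x : (cube n).Space) : f.spaceMap (l +ᵥ x) = f.spaceMap x := by
  apply Subtype.ext
  change pushWeights f.toFun (pushWeights (fun v : Bits n => (l : Bits n) + v) x.1) =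
    pushWeights f.toFun x.1
  rw [pushWeights_comp]
  simp only [f.toFun_vadd]

/-- If two points have the same image, a vertex in the support of `x` lies over the same vertex of
`A` as one in the support of `y`. A code translation makes these vertices equal, and then
`cubeWeights_eq_of_pushWeights_eq` applies. -/
theorem isOrbitMap_spaceMap : IsOrbitMap f.code f.spaceMap := by
  refine ⟨f.spaceMap_surjective f.toFun_surjective f.isOrbitMap_edgeMap.1 f.isOrbitMap_faceMap.1,
    fun x y => ⟨fun h => ?_, ?_⟩⟩
  · have hxy : pushWeights f.toFun x.1 = pushWeights f.toFun y.1 := congrArg Subtype.val h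
    obtain ⟨p, hp, hpx⟩ := exists_cubeWeights x
    obtain ⟨q, hq, hqy⟩ := exists_cubeWeights y
    have hv := pushWeights_apply_ne_zero (f := f.toFun) (cubeWeights_nonneg hp.1)
      (cubeWeights_roundBits p)
    rw [hpx, hxy] at hv
    obtain ⟨u, hu, hu0⟩ := exists_of_pushWeights_ne_zero hv
    obtain ⟨l, hl⟩ := f.exists_vadd_of_toFun_eq hu.symm
    refine ⟨l, ?_⟩
    obtain ⟨r, hr, hrx⟩ := exists_cubeWeights (l +ᵥ x)
    have hru : cubeWeights r u ≠ 0 := by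
      rw [hrx, ← hl]
      change ((l : Bits n) +ᵥ x).1 _ ≠ 0
      rw [vadd_space_apply, ← hpx]
      exact cubeWeights_roundBits p
    apply Subtype.ext
    rw [← hrx, ← hqy]
    refine f.cubeWeights_eq_of_pushWeights_eq hr hq hru (hqy ▸ hu0) ?_
    rw [hrx, hqy, ← hxy]
    exact congrArg Subtype.val (f.spaceMap_vadd l x)
  · rintro ⟨l, rfl⟩
    exact (f.spaceMap_vadd l x).symm

/-- A translation fixing a point permutes the vertices of its support, which differ pairwise in at
most two bits. -/
theorem actsFreely_space : ActsFreely f.code (cube n).Space := by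
  intro l x h
  obtain ⟨p, hp, hpx⟩ := exists_cubeWeights x
  have h0 := cubeWeights_roundBits p
  have h1 : cubeWeights p ((l : Bits n) + roundBits p) ≠ 0 := by
    have h' : ((l : Bits n) +ᵥ x) = x := h
    rw [hpx, ← h', vadd_space_apply, ← hpx]
    exact h0
  rw [cubeWeights_ne_zero_iff_of_ne_zero h0, add_sub_cancel_right] at h1
  exact Subtype.ext (f.eq_zero_of_card_le l.2
    (((Finset.card_le_card h1).trans hp.2.2).trans (by norm_num)))

theorem isQuotientMap_spaceMap : Topology.IsQuotientMap f.spaceMap :=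
  f.continuous_spaceMap.isClosedMap.isQuotientMap f.continuous_spaceMap f.isOrbitMap_spaceMap.1

theorem spaceMap_eq_iff_mem_orbit {x y : (cube n).Space} :
    f.spaceMap x = f.spaceMap y ↔ x ∈ AddAction.orbit f.code y := by
  rw [eq_comm, f.isOrbitMap_spaceMap.2]
  exact Iff.rfl

/-- The code is finite, so its free continuous action on a compact Hausdorff space is properly
discontinuous, and the projection is a quotient map whose fibres are the orbits. -/
theorem isCoveringMap_spaceMap : IsCoveringMap f.spaceMap := by
  have : IsCancelVAdd f.code (cube n).Space :=
    isCancelVAdd_iff_eq_zero_of_vadd_eq.2 fun l x h => f.actsFreely_space l x h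
  exact (f.isQuotientMap_spaceMap.isAddQuotientCoveringMap_of_properlyDiscontinuousVAdd
    (G := f.code) f.spaceMap_eq_iff_mem_orbit).isCoveringMap

theorem exists_homeomorph_orbitSpace :
    ∃ h : Quotient (AddAction.orbitRel f.code (cube n).Space) ≃ₜ A.Space,
      ∀ x : (cube n).Space, h (Quotient.mk _ x) = f.spaceMap x := by
  have hrel : ∀ x y : (cube n).Space,
      (AddAction.orbitRel f.code (cube n).Space) x y ↔ f.spaceMap x = f.spaceMap y :=
    fun x y => f.spaceMap_eq_iff_mem_orbit.symm
  let g : Quotient (AddAction.orbitRel f.code (cube n).Space) → A.Space :=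
    Quotient.lift f.spaceMap fun x y h => (hrel x y).1 h
  have hg : Function.Bijective g := by
    constructor
    · intro x y
      induction x using Quotient.inductionOn
      induction y using Quotient.inductionOn
      intro h
      exact Quotient.sound ((hrel _ _).2 h)
    · intro y
      obtain ⟨x, rfl⟩ := f.isOrbitMap_spaceMap.1 y
      exact ⟨Quotient.mk _ x, rfl⟩
  have hc : Continuous g := f.continuous_spaceMap.quotient_lift _
  exact ⟨hc.homeoOfEquivCompactToT2 (f := Equiv.ofBijective g hg), fun x => rfl⟩

theorem isQuotientComplex : IsQuotientComplex f.code f where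
  vertices := f.isOrbitMap_toFun
  edges := f.isOrbitMap_edgeMap
  faces := f.isOrbitMap_faceMap
  boundary₁_comm := f.chainMap_boundary₁
  boundary₂_comm := f.chainMap_boundary₂
  chains₀ := ⟨f.isOrbitMap_toFun.range_chainMap, f.isOrbitMap_toFun.ker_chainMap⟩
  chains₁ := ⟨f.isOrbitMap_edgeMap.range_chainMap, f.isOrbitMap_edgeMap.ker_chainMap⟩
  chains₂ := ⟨f.isOrbitMap_faceMap.range_chainMap, f.isOrbitMap_faceMap.ker_chainMap⟩
  homeomorph := f.exists_homeomorph_orbitSpace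
  vertexCell_image := f.spaceMap_image_vertexCell
  edgeCell_image := f.spaceMap_image_edgeCell
  faceCell_image := f.spaceMap_image_faceCell

/-- Translation by a word of the code, as a homeomorphism. -/
def translateHomeomorph (l : f.code) : (cube n).Space ≃ₜ (cube n).Space where
  toFun x := l +ᵥ x
  invFun x := -l +ᵥ x
  left_inv x := neg_vadd_vadd l x
  right_inv x := vadd_neg_vadd l x
  continuous_toFun := continuous_const_vadd l
  continuous_invFun := continuous_const_vadd (-l)

/-- The translations by the code are deck transformations. -/
def codeToDeck : Multiplicative f.code →* deckGroup f.spaceMap where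
  toFun l := ⟨f.translateHomeomorph l.toAdd, fun x => f.spaceMap_vadd l.toAdd x⟩
  map_one' := Subtype.ext (Homeomorph.ext fun x => zero_vadd f.code x)
  map_mul' l m := Subtype.ext (Homeomorph.ext fun x => add_vadd l.toAdd m.toAdd x)

/-- Injectivity is freeness at one point. For surjectivity, a deck transformation moves `x₀` within
its orbit, so some code translation agrees with it there; both lift the projection, and lifts on a
connected space that agree at one point are equal. -/
theorem codeToDeck_bijective : Function.Bijective f.codeToDeck := by
  have : SimplyConnectedSpace (cube n).Space := simplyConnectedSpace_cube
  obtain ⟨x₀⟩ : Nonempty (cube n).Space := inferInstance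
  constructor
  · rw [injective_iff_map_eq_one]
    intro l hl
    have h : l.toAdd +ᵥ x₀ = x₀ :=
      congrArg (fun h : deckGroup f.spaceMap => (h : (cube n).Space ≃ₜ (cube n).Space) x₀) hl
    exact f.actsFreely_space l.toAdd x₀ h
  · rintro ⟨h, hh⟩
    obtain ⟨l, hl⟩ := (f.isOrbitMap_spaceMap.2 _ _).1 (hh x₀).symm
    refine ⟨Multiplicative.ofAdd l, Subtype.ext (Homeomorph.ext fun x => ?_)⟩
    have heq := f.isCoveringMap_spaceMap.eq_of_comp_eq (g₁ := fun x => l +ᵥ x) (g₂ := h)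
      (continuous_const_vadd l) h.continuous
      (funext fun x => (f.spaceMap_vadd l x).trans (hh x).symm) x₀ hl
    exact congrFun heq x

theorem exists_codeEquivDeck : ∃ e : Multiplicative f.code ≃* deckGroup f.spaceMap,
    ∀ (l : f.code) (x : (cube n).Space),
      (e (Multiplicative.ofAdd l) : (cube n).Space ≃ₜ (cube n).Space) x = l +ᵥ x :=
  ⟨MulEquiv.ofBijective f.codeToDeck f.codeToDeck_bijective, fun _ _ => rfl⟩

end ColorHom

end Orbits

end Adinkra
end

theorem mainTheorem10 {n : ℕ} {V : Type*} [Fintype V] [DecidableEq V]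
    (A : Adinkra.Chromotopology n V) (hA : A.Adinkraizable) :
    (∃! L : Submodule (ZMod 2) (Adinkra.Bits n), Nonempty (Adinkra.CodeLabelling A L)) ∧
    ∀ (L : Submodule (ZMod 2) (Adinkra.Bits n)) (φ : Adinkra.CodeLabelling A L),
      (Adinkra.IsQuotientComplex L φ.proj ∧
        Adinkra.ActsFreely L (Adinkra.Bits n) ∧
        Adinkra.ActsFreely L (Adinkra.cube n).Edge ∧
        Adinkra.ActsFreely L (Adinkra.cube n).Face ∧
        Adinkra.ActsFreely L (Adinkra.cube n).Space) ∧
      SimplyConnectedSpace (Adinkra.cube n).Space ∧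
      IsCoveringMap φ.proj.spaceMap ∧
      ∃ e : Multiplicative L ≃* Adinkra.deckGroup φ.proj.spaceMap,
        ∀ (l : L) (x : (Adinkra.cube n).Space),
          (e (Multiplicative.ofAdd l) : (Adinkra.cube n).Space ≃ₜ (Adinkra.cube n).Space) x =
            l +ᵥ x := by
  refine ⟨Adinkra.existsUnique_code A, fun L φ => ?_⟩
  -- Generalizing the projection to any `f` with code `L` allows `L` to be replaced by `f.code`,
  -- without transporting dependent types along `φ.code_proj`.
  have key : ∀ f : Adinkra.ColorHom (Adinkra.cube n) A, f.code = L →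
      (Adinkra.IsQuotientComplex L f ∧
        Adinkra.ActsFreely L (Adinkra.Bits n) ∧
        Adinkra.ActsFreely L (Adinkra.cube n).Edge ∧
        Adinkra.ActsFreely L (Adinkra.cube n).Face ∧
        Adinkra.ActsFreely L (Adinkra.cube n).Space) ∧
      SimplyConnectedSpace (Adinkra.cube n).Space ∧
      IsCoveringMap f.spaceMap ∧
      ∃ e : Multiplicative L ≃* Adinkra.deckGroup f.spaceMap,
        ∀ (l : L) (x : (Adinkra.cube n).Space),
          (e (Multiplicative.ofAdd l) : (Adinkra.cube n).Space ≃ₜ (Adinkra.cube n).Space) x =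
            l +ᵥ x := by
    rintro f rfl
    exact ⟨⟨f.isQuotientComplex, f.actsFreely_vertices, f.actsFreely_edges, f.actsFreely_faces,
      f.actsFreely_space⟩, Adinkra.simplyConnectedSpace_cube, f.isCoveringMap_spaceMap,
      f.exists_codeEquivDeck⟩
  exact key φ.proj φ.code_proj
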